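/- Let $n\ge 0$, let $V\in C([0,1];\mathbb R^{n\times n})$ with $V(x)$ symmetric for every $x$, and let $\alpha_1,\alpha_2,\beta_1,\beta_2\in\mathbb R^{n\times n}$ satisfy $\operatorname{rank}[\alpha_1\ \alpha_2]=\operatorname{rank}[\beta_1\ \beta_2]=n$, $\alpha_1\alpha_2^t-\alpha_2\alpha_1^t=0$ and $\beta_1\beta_2^t-\beta_2\beta_1^t=0$. Let $H=-\frac{d^2}{dx^2}+V$ in $L^2((0,1);\mathbb R^n)$ with domain $$\{y\in H^2(0,1):\ \alpha_1y(0)+\alpha_2y'(0)=0,\ \beta_1y(1)+\beta_2y'(1)=0\},$$ and let the Morse index $\operatorname{Mor}(H)$ be the number of negative eigenvalues of $H$, counted with multiplicity. For $\lambda\in\mathbb R$ let $\ell(1,\lambda)\subset\mathbb R^{2n}$ be the set of the values $(y(1),y'(1))$ of all solutions of $-y''+Vy=\lambda y$ on $[0,1]$ with $\alpha_1y(0)+\alpha_2y'(0)=0$, and let $\ell_1=\{(p,q)\in\mathbb R^{2n}:\beta_1p+\beta_2q=0\}$. Maslov index. Let $J=\begin{pmatrix}0&-I_n\\ I_n&0\end{pmatrix}$;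 a subspace $\ell\subset\mathbb R^{2n}$ is Lagrangian if $\dim\ell=n$ and $(Jx,y)_{\mathbb R^{2n}}=0$ for all $x,y\in\ell$. Let $\Pi_\ell$ be the orthogonal projection onto $\ell$. For Lagrangian $\ell$ the matrix $W=(I-2\Pi_\ell)(2\Pi_{\ell_1}-I)$ commutes with $J$, so it has the form $\begin{pmatrix}W_{11}&-W_{21}\\ W_{21}&W_{11}\end{pmatrix}$, and $\tilde W=W_{11}+iW_{21}$ is a unitary $n\times n$ matrix. For a continuous path $\Upsilon$ of Lagrangian subspaces on $[a,b]$, with matrices $\tilde W_t$, choose $a=t_0<\dots<t_N=b$ and $\epsilon_j\in(0,\pi)$ with $e^{i(\pi\pm\epsilon_j)}\notin\sigma(\tilde W_t)$ for $t\in[t_{j-1},t_j]$, and put $$\operatorname{Mas}(\Upsilon,\ell_1;[a,b])=\sum_{j=1}^N\big(k(t_j,\epsilon_j)-k(t_{j-1},\epsilon_j)\big),\qquad k(t,\epsilon)=\sum_{0\le\theta<\epsilon}\dim\ker\big(\tilde W_t-e^{i(\pi+\theta)}I\big).$$ Then $\operatorname{Mor}(H)$ is finite, and there is $\lambda_\infty>0$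 such that $\ell(1,\lambda)\cap\ell_1=\{0\}$ for all $\lambda<-\lambda_\infty$. For every $\lambda_\infty>0$ with this property, let $\Gamma_3$ be the path $\lambda=-t$, $t\in[0,\lambda_\infty]$, along which $\lambda$ decreases from $0$ to $-\lambda_\infty$. Then $\ell(1,\cdot)$ is a continuous path of Lagrangian subspaces along $\Gamma_3$, $\ell_1$ is Lagrangian, the Maslov index of the path is defined (partitions as above exist, and all of them give the same value), and $$\operatorname{Mas}(\ell,\ell_1;\Gamma_3)=\operatorname{Mor}(H).$$ -/

import Mathlib

open MeasureTheory

noncomputable section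

namespace MaslovMorse

variable {n : ℕ}

/-- `ℝⁿ` with the Euclidean inner product. -/
abbrev Vec (n : ℕ) : Type := EuclideanSpace ℝ (Fin n)

/-- `ℝ²ⁿ` with the Euclidean inner product; a vector is a pair `(p, q)`, where `p` has the
coordinates indexed by `Sum.inl` and `q` those indexed by `Sum.inr`. -/
abbrev PhaseSpace (n : ℕ) : Type := EuclideanSpace ℝ (Fin n ⊕ Fin n)

/-- Real `2n × 2n` matrices in `n × n` blocks. -/
abbrev PhaseMatrix (n : ℕ) : Type := Matrix (Fin n ⊕ Fin n) (Fin n ⊕ Fin n) ℝ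

/-! ### Lagrangian subspaces and the Maslov index -/

/-- The standard symplectic matrix with blocks `0, -I` (first row) and `I, 0` (second row). -/
def symplJ (n : ℕ) : PhaseMatrix n := Matrix.fromBlocks 0 (-1) 1 0

/-- The symplectic form `ω(x, y) = (J x, y)`. -/
def omega (x y : PhaseSpace n) : ℝ := inner ℝ (Matrix.toEuclideanCLM (𝕜 := ℝ) (symplJ n) x) y

/-- A Lagrangian subspace: dimension `n`, and `ω` vanishes on it. -/
def IsLagrangian (l : Submodule ℝ (PhaseSpace n)) : Prop :=
  Module.finrank ℝ l = n ∧ ∀ x ∈ l, ∀ y ∈ l, omega x y = 0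

/-- The matrix of the orthogonal projection onto a subspace of `ℝ²ⁿ`. -/
def projMatrix (l : Submodule ℝ (PhaseSpace n)) : PhaseMatrix n :=
  (Matrix.toEuclideanCLM (𝕜 := ℝ) (n := Fin n ⊕ Fin n)).symm l.starProjection

/-- The conjugation `τ = 2 Π - I` of `ℝ²ⁿ` with respect to the target `l₁`. -/
def conjMatrix (l₁ : Submodule ℝ (PhaseSpace n)) : PhaseMatrix n :=
  2 * projMatrix l₁ - 1

/-- The matrix `W = (I - 2 Π_l) (2 Π_{l₁} - I)`. By `wMatrix_eq_mul` below, it is the matrix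
`U Uᵀ'` with `Uᵀ' = τ Uᵀ τ`, for any unitary matrix `U` which maps `l₁ᗮ` to `l`. -/
def wMatrix (l l₁ : Submodule ℝ (PhaseSpace n)) : PhaseMatrix n :=
  (1 - 2 * projMatrix l) * conjMatrix l₁

theorem wMatrix_eq_mul (l l₁ : Submodule ℝ (PhaseSpace n)) (U : PhaseMatrix n)
    (hU : U * U.transpose = 1)
    (hl : l = (l₁ᗮ).map
      (Matrix.toEuclideanCLM (𝕜 := ℝ) U : PhaseSpace n →ₗ[ℝ] PhaseSpace n)) :
    wMatrix l l₁ = U * (conjMatrix l₁ * U.transpose * conjMatrix l₁) := by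
  have hU' : U.transpose * U = 1 := mul_eq_one_comm.mp hU
  have hs : star U = U.transpose := by
    rw [Matrix.star_eq_conjTranspose, Matrix.conjTranspose_eq_transpose_of_trivial]
  set φ := Matrix.toEuclideanCLM (𝕜 := ℝ) (n := Fin n ⊕ Fin n) with hφ
  have hadj : ContinuousLinearMap.adjoint (φ U) = φ U.transpose := by
    rw [← ContinuousLinearMap.star_eq_adjoint, ← map_star, hs]
  have hinv : ∀ x, φ U.transpose (φ U x) = x := fun x => by
    rw [← mul_apply_eq_comp, ← map_mul, hU', map_one, one_apply_eq_self]
  have key : l.starProjection = φ (U * (1 - projMatrix l₁) * U.transpose) := by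
    have h1 : φ (1 - projMatrix l₁) = l₁ᗮ.starProjection := by
      rw [map_sub, map_one, projMatrix, StarAlgEquiv.apply_symm_apply,
        Submodule.starProjection_orthogonal']
    ext1 x
    rw [map_mul, map_mul, h1, mul_apply_eq_comp, mul_apply_eq_comp]
    apply Submodule.eq_starProjection_of_mem_orthogonal
    · rw [hl]
      exact Submodule.mem_map_of_mem (Submodule.starProjection_apply_mem _ _)
    · rw [hl, Submodule.mem_orthogonal]
      rintro _ ⟨k, hk, rfl⟩
      have h2 : ∀ z, inner ℝ (φ U k) z = inner ℝ k (φ U.transpose z) := fun z => by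
        rw [← hadj, ContinuousLinearMap.adjoint_inner_right]
      have h3 := Submodule.sub_starProjection_mem_orthogonal (K := l₁ᗮ) (φ U.transpose x)
      have h4 := (Submodule.mem_orthogonal _ _).1 h3 k hk
      change inner ℝ (φ U k) _ = 0
      rw [h2, map_sub, hinv]
      exact h4
  have hP : projMatrix l = U * (1 - projMatrix l₁) * U.transpose := by
    rw [projMatrix, key]
    exact StarAlgEquiv.symm_apply_apply _ _
  rw [wMatrix, hP]
  have : (1 - 2 * (U * (1 - projMatrix l₁) * U.transpose)) = U * conjMatrix l₁ * U.transpose := by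
    rw [conjMatrix]
    nth_rewrite 1 [← hU]
    noncomm_ring
  rw [this]
  simp only [mul_assoc]

/-- The complex `n × n` matrix `W₁₁ + i W₂₁` that corresponds to a real `2n × 2n` matrix `W`
commuting with `J`. -/
def complexMatrix (W : PhaseMatrix n) : Matrix (Fin n) (Fin n) ℂ :=
  W.toBlocks₁₁.map Complex.ofReal + Complex.I • W.toBlocks₂₁.map Complex.ofReal

/-- The complex unitary matrix `W̃` attached to a Lagrangian subspace `l` and the target `l₁`. -/
def wTilde (l l₁ : Submodule ℝ (PhaseSpace n)) : Matrix (Fin n) (Fin n) ℂ :=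
  complexMatrix (wMatrix l l₁)

/-- `ker (A - e^{i(π + θ)} I)`. -/
def circleEigenspace (A : Matrix (Fin n) (Fin n) ℂ) (θ : ℝ) : Submodule ℂ (Fin n → ℂ) :=
  Module.End.eigenspace (Matrix.toLin' A) (Complex.exp (Complex.I * ((Real.pi + θ : ℝ) : ℂ)))

/-- The number, with multiplicity, of the eigenvalues of `A` on the arc `e^{i(π + θ)}`,
`0 ≤ θ < ε`. For `ε ≤ 2π` only finitely many terms of the sum are nonzero. -/
def arcCount (A : Matrix (Fin n) (Fin n) ℂ) (ε : ℝ) : ℕ :=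
  ∑ᶠ θ ∈ Set.Ico (0 : ℝ) ε, Module.finrank ℂ (circleEigenspace A θ)

/-- A partition `a = t₀ < t₁ < ⋯ < t_N = b` and numbers `ε_j ∈ (0, π)` such that
`e^{i(π ± ε_j)}` is not an eigenvalue of `A t` for `t ∈ [t_{j-1}, t_j]`. -/
structure FlowPartition (A : ℝ → Matrix (Fin n) (Fin n) ℂ) (a b : ℝ) where
  N : ℕ
  t : Fin (N + 1) → ℝ
  ε : Fin N → ℝ
  strictMono : StrictMono t
  t_zero : t 0 = a
  t_last : t (Fin.last N) = b
  ε_mem : ∀ j, ε j ∈ Set.Ioo 0 Real.pi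
  gap : ∀ j, ∀ τ ∈ Set.Icc (t j.castSucc) (t j.succ),
    circleEigenspace (A τ) (ε j) = ⊥ ∧ circleEigenspace (A τ) (-ε j) = ⊥

/-- The sum `∑_j (k(t_j, ε_j) - k(t_{j-1}, ε_j))`. -/
def FlowPartition.flow {A : ℝ → Matrix (Fin n) (Fin n) ℂ} {a b : ℝ}
    (P : FlowPartition A a b) : ℤ :=
  ∑ j : Fin P.N,
    ((arcCount (A (P.t j.succ)) (P.ε j) : ℤ) - (arcCount (A (P.t j.castSucc)) (P.ε j) : ℤ))

/-- `m` is the Maslov index of the path `Υ : [a, b] → Λ(n)` with respect to the target `l₁`: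
the path is a continuous path of Lagrangian subspaces (for the distance `‖Π - Π'‖` between
the orthogonal projections), and the spectral flow of `W̃` through `-1` along it, computed
with any partition (and there is one), is `m`. -/
structure HasMaslovIndex (Υ : ℝ → Submodule ℝ (PhaseSpace n))
    (l₁ : Submodule ℝ (PhaseSpace n)) (a b : ℝ) (m : ℤ) : Prop where
  target : IsLagrangian l₁
  lagrangian : ∀ t ∈ Set.Icc a b, IsLagrangian (Υ t)
  continuous : ContinuousOn (fun t => projMatrix (Υ t)) (Set.Icc a b)
  exists_partition : Nonempty (FlowPartition (fun t => wTilde (Υ t) l₁) a b)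
  flow_eq : ∀ P : FlowPartition (fun t => wTilde (Υ t) l₁) a b, P.flow = m

/-! ### The Schrödinger operator and its Morse index -/

/-- `u` belongs to the Sobolev space `H¹(0, s)` (`u` being the continuous representative, on
`[0, s]`), with weak derivative `g ∈ L²(0, s)`. -/
def HasWeakDeriv {E : Type*} [NormedAddCommGroup E] [NormedSpace ℝ E] (s : ℝ)
    (u g : ℝ → E) : Prop :=
  MemLp g 2 (volume.restrict (Set.Icc 0 s)) ∧
    ∀ x ∈ Set.Icc 0 s, u x = u 0 + ∫ t in (0 : ℝ)..x, g t

theorem HasWeakDeriv.intervalIntegrable {E : Type*} [NormedAddCommGroup E] [NormedSpace ℝ E]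
    {s : ℝ} {u g : ℝ → E} (h : HasWeakDeriv s u g) {x : ℝ} (hx : x ∈ Set.Icc 0 s) :
    IntervalIntegrable g volume 0 x := by
  have h1 : IntegrableOn g (Set.Icc 0 s) volume := h.1.integrable one_le_two
  rw [intervalIntegrable_iff_integrableOn_Icc_of_le hx.1]
  exact h1.mono_set (Set.Icc_subset_Icc_right hx.2)

theorem HasWeakDeriv.add {E : Type*} [NormedAddCommGroup E] [NormedSpace ℝ E] {s : ℝ}
    {u g v k : ℝ → E} (h : HasWeakDeriv s u g) (h' : HasWeakDeriv s v k) :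
    HasWeakDeriv s (u + v) (g + k) := by
  refine ⟨h.1.add h'.1, fun x hx => ?_⟩
  have := intervalIntegral.integral_add (h.intervalIntegrable hx) (h'.intervalIntegrable hx)
  simp only [Pi.add_apply]
  rw [this, h.2 x hx, h'.2 x hx]
  abel

theorem HasWeakDeriv.smul {E : Type*} [NormedAddCommGroup E] [NormedSpace ℝ E] {s : ℝ}
    (c : ℝ) {u g : ℝ → E} (h : HasWeakDeriv s u g) : HasWeakDeriv s (c • u) (c • g) := by
  refine ⟨h.1.const_smul c, fun x hx => ?_⟩
  simp only [Pi.smul_apply]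
  rw [intervalIntegral.integral_smul, h.2 x hx, smul_add]

theorem HasWeakDeriv.zero {E : Type*} [NormedAddCommGroup E] [NormedSpace ℝ E] (s : ℝ) :
    HasWeakDeriv s (0 : ℝ → E) 0 :=
  ⟨MemLp.zero', fun x _ => by simp⟩

/-- The boundary conditions `α₁ y(0) + α₂ y'(0) = 0` and similar ones:
`a₁ p + a₂ q = 0`. -/
def BoundaryCond (a₁ a₂ : Matrix (Fin n) (Fin n) ℝ) (p q : Fin n → ℝ) : Prop :=
  a₁.mulVec p + a₂.mulVec q = 0

theorem BoundaryCond.add {a₁ a₂ : Matrix (Fin n) (Fin n) ℝ} {p q p' q' : Fin n → ℝ}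
    (h : BoundaryCond a₁ a₂ p q) (h' : BoundaryCond a₁ a₂ p' q') :
    BoundaryCond a₁ a₂ (p + p') (q + q') := by
  unfold BoundaryCond at *
  rw [Matrix.mulVec_add, Matrix.mulVec_add, add_add_add_comm, h, h', add_zero]

theorem BoundaryCond.smul {a₁ a₂ : Matrix (Fin n) (Fin n) ℝ} (c : ℝ) {p q : Fin n → ℝ}
    (h : BoundaryCond a₁ a₂ p q) : BoundaryCond a₁ a₂ (c • p) (c • q) := by
  unfold BoundaryCond at *
  rw [Matrix.mulVec_smul, Matrix.mulVec_smul, ← smul_add, h, smul_zero]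

theorem BoundaryCond.zero (a₁ a₂ : Matrix (Fin n) (Fin n) ℝ) : BoundaryCond a₁ a₂ 0 0 := by
  simp [BoundaryCond]

/-- `L²((0, 1); ℝⁿ)`. -/
abbrev L2 (n : ℕ) : Type := Lp (Vec n) 2 (volume.restrict (Set.Icc (0 : ℝ) 1))

/-- The graph of the operator `H y = -y'' + V y` in `L²((0, 1); ℝⁿ)` with domain
`{y ∈ H²(0, 1) : α₁ y(0) + α₂ y'(0) = 0, β₁ y(1) + β₂ y'(1) = 0}`: the pairs `(f, h)` such that
`f` is represented by a function `y` in the domain and `h` by `-y'' + V y`. -/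
def schrodingerGraph (V : ℝ → Matrix (Fin n) (Fin n) ℝ)
    (α₁ α₂ β₁ β₂ : Matrix (Fin n) (Fin n) ℝ) : Submodule ℝ (L2 n × L2 n) where
  carrier := {fh | ∃ y y' y'' : ℝ → Vec n,
    HasWeakDeriv 1 y y' ∧ HasWeakDeriv 1 y' y'' ∧
    BoundaryCond α₁ α₂ (y 0) (y' 0) ∧ BoundaryCond β₁ β₂ (y 1) (y' 1) ∧
    (∀ᵐ x ∂(volume.restrict (Set.Icc (0 : ℝ) 1)), fh.1 x = y x) ∧
    (∀ᵐ x ∂(volume.restrict (Set.Icc (0 : ℝ) 1)),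
      fh.2 x = -y'' x + Matrix.toEuclideanCLM (𝕜 := ℝ) (V x) (y x))}
  add_mem' := by
    rintro f g ⟨y, y', y'', h1, h2, h3, h4, h5, h6⟩ ⟨z, z', z'', k1, k2, k3, k4, k5, k6⟩
    refine ⟨y + z, y' + z', y'' + z'', h1.add k1, h2.add k2, h3.add k3, h4.add k4, ?_, ?_⟩
    · filter_upwards [h5, k5, Lp.coeFn_add f.1 g.1] with x a b c
      rw [Prod.fst_add, c, Pi.add_apply, Pi.add_apply, a, b]
    · filter_upwards [h6, k6, Lp.coeFn_add f.2 g.2] with x a b c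
      rw [Prod.snd_add, c, Pi.add_apply, Pi.add_apply, Pi.add_apply, a, b, map_add]
      abel
  zero_mem' := by
    refine ⟨0, 0, 0, HasWeakDeriv.zero 1, HasWeakDeriv.zero 1, BoundaryCond.zero _ _,
      BoundaryCond.zero _ _, ?_, ?_⟩
    · filter_upwards [Lp.coeFn_zero (Vec n) 2 (volume.restrict (Set.Icc (0 : ℝ) 1))] with x a
      simpa using a
    · filter_upwards [Lp.coeFn_zero (Vec n) 2 (volume.restrict (Set.Icc (0 : ℝ) 1))] with x a
      simpa using a
  smul_mem' := by
    rintro c f ⟨y, y', y'', h1, h2, h3, h4, h5, h6⟩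
    refine ⟨c • y, c • y', c • y'', h1.smul c, h2.smul c, h3.smul c, h4.smul c, ?_, ?_⟩
    · filter_upwards [h5, Lp.coeFn_smul c f.1] with x a b
      rw [Prod.smul_fst, b, Pi.smul_apply, Pi.smul_apply, a]
    · filter_upwards [h6, Lp.coeFn_smul c f.2] with x a b
      rw [Prod.smul_snd, b, Pi.smul_apply, Pi.smul_apply, Pi.smul_apply, a, map_smul,
        smul_add, smul_neg]

/-- The eigenspace `{f : H f = μ f}` of `H`. -/
def eigenspaceH (V : ℝ → Matrix (Fin n) (Fin n) ℝ)
    (α₁ α₂ β₁ β₂ : Matrix (Fin n) (Fin n) ℝ) (μ : ℝ) : Submodule ℝ (L2 n) :=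
  (schrodingerGraph V α₁ α₂ β₁ β₂).comap
    (LinearMap.prod LinearMap.id (μ • LinearMap.id))

/-- The Morse index of `H`: the number of its negative eigenvalues, counted with
multiplicity. -/
def morseIndex (V : ℝ → Matrix (Fin n) (Fin n) ℝ)
    (α₁ α₂ β₁ β₂ : Matrix (Fin n) (Fin n) ℝ) : ℕ∞ :=
  ∑' μ : Set.Iio (0 : ℝ), Cardinal.toENat (Module.rank ℝ (eigenspaceH V α₁ α₂ β₁ β₂ μ))

/-! ### The Lagrangian subspaces of the boundary value problem -/

/-- The matrix of the first order system: blocks `0, I` (first row) and `V(x) - λ I, 0`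
(second row). -/
def systemMatrix (V : ℝ → Matrix (Fin n) (Fin n) ℝ) (lam x : ℝ) : PhaseMatrix n :=
  Matrix.fromBlocks 0 1 (V x - lam • 1) 0

/-- The space of the solutions `𝐩 = (p, q) ∈ H¹(0, s)` of `𝐩' = 𝔸(x; λ) 𝐩` which satisfy
`α₁ p(0) + α₂ q(0) = 0` (functions on `ℝ`, of which only the values on `[0, s]` matter). -/
def solutionSpace (V : ℝ → Matrix (Fin n) (Fin n) ℝ) (α₁ α₂ : Matrix (Fin n) (Fin n) ℝ)
    (s lam : ℝ) : Submodule ℝ (ℝ → PhaseSpace n) where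
  carrier := {p | ∃ p' : ℝ → PhaseSpace n, HasWeakDeriv s p p' ∧
    (∀ᵐ x ∂(volume.restrict (Set.Icc (0 : ℝ) s)),
      p' x = Matrix.toEuclideanCLM (𝕜 := ℝ) (systemMatrix V lam x) (p x)) ∧
    BoundaryCond α₁ α₂ (fun i => p 0 (Sum.inl i)) (fun i => p 0 (Sum.inr i))}
  add_mem' := by
    rintro p r ⟨p', h1, h2, h3⟩ ⟨r', k1, k2, k3⟩
    refine ⟨p' + r', h1.add k1, ?_, h3.add k3⟩
    filter_upwards [h2, k2] with x a b
    rw [Pi.add_apply, Pi.add_apply, a, b, map_add]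
  zero_mem' := by
    refine ⟨0, HasWeakDeriv.zero s, ?_, BoundaryCond.zero _ _⟩
    filter_upwards with x
    simp
  smul_mem' := by
    rintro c p ⟨p', h1, h2, h3⟩
    refine ⟨c • p', h1.smul c, ?_, h3.smul c⟩
    filter_upwards [h2] with x a
    rw [Pi.smul_apply, Pi.smul_apply, a, map_smul]

/-- The space `ℓ(s, λ)` of the traces `𝐩(s)` of these solutions. -/
def traceSpace (V : ℝ → Matrix (Fin n) (Fin n) ℝ) (α₁ α₂ : Matrix (Fin n) (Fin n) ℝ)
    (s lam : ℝ) : Submodule ℝ (PhaseSpace n) :=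
  (solutionSpace V α₁ α₂ s lam).map (LinearMap.proj s)

/-- The target `ℓ₁`: the vectors `(p, q)` with `β₁ p + β₂ q = 0`. -/
def targetSpace (β₁ β₂ : Matrix (Fin n) (Fin n) ℝ) : Submodule ℝ (PhaseSpace n) where
  carrier := {v | BoundaryCond β₁ β₂ (fun i => v (Sum.inl i)) (fun i => v (Sum.inr i))}
  add_mem' := fun h k => BoundaryCond.add h k
  zero_mem' := BoundaryCond.zero _ _
  smul_mem' := fun c _ h => BoundaryCond.smul c h

end MaslovMorse

end

open MaslovMorse

/-! The eigenvalue e^{i(π+θ)} of `wTilde l l₁` has multiplicity dim(l ∩ e^{(θ/2)J} l₁)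
(`finrank_circleEigenspace`). So -1 is an eigenvalue exactly when l meets l₁, and for l = ℓ(1,λ)
this means that λ is an eigenvalue of H, with the same multiplicity (`toENat_rank_eigenspaceH`).
What remains is that, as λ decreases, every crossing counts with its full dimension and with a plus
sign.

Eigenvalues on the circle are not followed individually; the count on an arc becomes an inertia
index. Put φ = ε/2 and split ℝ²ⁿ into l₁ and e^{φJ} l₁. If e^{i(π+ε)} is not an eigenvalue, l is the
graph over l₁ of an operator N, symmetric because l is Lagrangian, with kernel isomorphic to l ∩ l₁.
The intersection of l with e^{(θ/2)J} l₁ corresponds to the eigenspace of N for sin(θ/2)/sin(φ-θ/2),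
a ratio that maps [0,ε) bijectively onto [0,∞). Hence `arcCount` is the number of nonnegative
eigenvalues of N (`arcCount_eq_nonnegCount`).

Monotonicity is the Lagrange identity `omega_monodromy`. With λ = -t it reads sin φ ⟨(N_s - N_t)a,
a⟩ = (s - t) B(y_t, y_s), where B is the L² pairing of solutions and is positive for s near t. So
N_t strictly increases: its count stays constant just to the right of t and is smaller by dim ker
N_t just to the left (`eventually_arcCount`). No derivative in the parameter is needed.

It follows that crossings are isolated and that, for every partition, the flow telescopes to the sum
of the crossing dimensions over t in (a,b] (`flow_eq`). For (0,L] this leaves out λ = 0 and keeps λ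
= -L, which is what the count of negative eigenvalues requires. An energy estimate excludes
crossings for very negative λ (`exists_forall_inf_eq_bot`), and so the sum is finite. -/

noncomputable section

namespace MaslovMorse

variable {n : ℕ}

/-! ### The complex structure `J` and the rotations `exp(φ J)` -/

/-- The complex structure `J(p, q) = (-q, p)`. -/
def Jmap (n : ℕ) : PhaseSpace n →L[ℝ] PhaseSpace n := Matrix.toEuclideanCLM (𝕜 := ℝ) (symplJ n)

@[simp] theorem Jmap_inl (x : PhaseSpace n) (i : Fin n) :
    Jmap n x (Sum.inl i) = -x (Sum.inr i) := by
  simp [Jmap, symplJ, Matrix.ofLp_toEuclideanCLM, Matrix.mulVec, dotProduct, Fintype.sum_sum_type,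
    Matrix.one_apply]

@[simp] theorem Jmap_inr (x : PhaseSpace n) (i : Fin n) : Jmap n x (Sum.inr i) = x (Sum.inl i) := by
  simp [Jmap, symplJ, Matrix.ofLp_toEuclideanCLM, Matrix.mulVec, dotProduct, Fintype.sum_sum_type,
    Matrix.one_apply]

@[simp] theorem Jmap_Jmap (x : PhaseSpace n) : Jmap n (Jmap n x) = -x := by
  ext (i | i) <;> simp

theorem omega_eq_inner (x y : PhaseSpace n) : omega x y = inner ℝ (Jmap n x) y := rfl

theorem inner_eq_sum (x y : PhaseSpace n) : inner ℝ x y =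
    ∑ i, x (Sum.inl i) * y (Sum.inl i) + ∑ i, x (Sum.inr i) * y (Sum.inr i) := by
  simp [PiLp.inner_apply, Fintype.sum_sum_type, mul_comm]

theorem inner_Jmap_Jmap (x y : PhaseSpace n) :
    inner ℝ (Jmap n x) (Jmap n y) = inner ℝ x y := by
  simp [inner_eq_sum, add_comm]

theorem inner_Jmap_left (x y : PhaseSpace n) :
    inner ℝ (Jmap n x) y = -inner ℝ x (Jmap n y) := by
  rw [← inner_Jmap_Jmap, Jmap_Jmap, inner_neg_left]

theorem omega_eq_sum (x y : PhaseSpace n) : omega x y =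
    ∑ i, x (Sum.inl i) * y (Sum.inr i) - ∑ i, x (Sum.inr i) * y (Sum.inl i) := by
  rw [omega_eq_inner, inner_eq_sum]
  simp
  ring

/-- The rotation `exp(φ J) = cos φ + sin φ J`. -/
def rot (φ : ℝ) : PhaseSpace n →L[ℝ] PhaseSpace n := Real.cos φ • 1 + Real.sin φ • Jmap n

theorem rot_apply (φ : ℝ) (x : PhaseSpace n) :
    rot φ x = Real.cos φ • x + Real.sin φ • Jmap n x := rfl

@[simp] theorem rot_zero (x : PhaseSpace n) : rot 0 x = x := by simp [rot_apply]

theorem rot_rot (φ ψ : ℝ) (x : PhaseSpace n) : rot φ (rot ψ x) = rot (φ + ψ) x := by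
  simp only [rot_apply, map_add, map_smul, Jmap_Jmap, Real.cos_add, Real.sin_add]
  module

theorem rot_Jmap (φ : ℝ) (x : PhaseSpace n) : rot φ (Jmap n x) = Jmap n (rot φ x) := by
  simp only [rot_apply, map_add, map_smul]

theorem inner_rot_rot (φ : ℝ) (x y : PhaseSpace n) :
    inner ℝ (rot φ x) (rot φ y) = inner ℝ x y := by
  simp only [rot_apply, inner_add_left, inner_add_right, inner_smul_left, inner_smul_right,
    inner_Jmap_Jmap, inner_Jmap_left x y]
  have := Real.sin_sq_add_cos_sq φ
  simp only [conj_trivial]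
  linear_combination (inner ℝ x y) * this

/-! ### Lagrangian subspaces -/

theorem finrank_map_of_injective {E F : Type*} [AddCommGroup E] [Module ℝ E] [AddCommGroup F]
    [Module ℝ F] {f : E →ₗ[ℝ] F} (hf : Function.Injective f) (p : Submodule ℝ E) :
    Module.finrank ℝ (p.map f) = Module.finrank ℝ p :=
  (Submodule.equivMapOfInjective f hf p).finrank_eq.symm

theorem finrank_phaseSpace : Module.finrank ℝ (PhaseSpace n) = n + n := by simp

theorem IsLagrangian.Jmap_mem_orthogonal {l : Submodule ℝ (PhaseSpace n)} (hl : IsLagrangian l)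
    {x : PhaseSpace n} (hx : x ∈ l) : Jmap n x ∈ lᗮ := by
  rw [Submodule.mem_orthogonal']
  exact fun y hy => hl.2 x hx y hy

theorem Jmap_injective : Function.Injective (Jmap n) := by
  intro x y h
  have := congrArg (Jmap n) h
  simpa using this

theorem IsLagrangian.map_Jmap {l : Submodule ℝ (PhaseSpace n)} (hl : IsLagrangian l) :
    l.map (Jmap n : PhaseSpace n →ₗ[ℝ] PhaseSpace n) = lᗮ := by
  apply Submodule.eq_of_le_of_finrank_eq
  · rintro _ ⟨x, hx, rfl⟩
    exact hl.Jmap_mem_orthogonal hx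
  · have := l.finrank_add_finrank_orthogonal
    rw [hl.1, finrank_phaseSpace] at this
    rw [finrank_map_of_injective Jmap_injective, hl.1]
    omega

theorem IsLagrangian.Jmap_mem {l : Submodule ℝ (PhaseSpace n)} (hl : IsLagrangian l)
    {x : PhaseSpace n} (hx : x ∈ lᗮ) : Jmap n x ∈ l := by
  rw [← hl.map_Jmap] at hx
  obtain ⟨y, hy, rfl⟩ := hx
  simpa using hy

/-- `J` exchanges `l` and `lᗮ`, so it carries the projection onto `l` to the complementary one.
Hence the reflection in `l` anticommutes with `J`, and the product of two such reflections commutes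
with it. -/
theorem IsLagrangian.starProjection_Jmap {l : Submodule ℝ (PhaseSpace n)} (hl : IsLagrangian l)
    (x : PhaseSpace n) :
    l.starProjection (Jmap n x) = Jmap n (x - l.starProjection x) := by
  apply Submodule.eq_starProjection_of_mem_orthogonal
  · exact hl.Jmap_mem (Submodule.sub_starProjection_mem_orthogonal x)
  · rw [← map_sub, sub_sub_cancel]
    exact hl.Jmap_mem_orthogonal (Submodule.starProjection_apply_mem _ _)

theorem IsLagrangian.reflection_Jmap {l : Submodule ℝ (PhaseSpace n)} (hl : IsLagrangian l)
    (x : PhaseSpace n) : l.reflection (Jmap n x) = -Jmap n (l.reflection x) := by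
  rw [Submodule.reflection_apply, Submodule.reflection_apply, hl.starProjection_Jmap]
  simp only [map_sub, map_nsmul]
  module

theorem IsLagrangian.reflection_rot {l : Submodule ℝ (PhaseSpace n)} (hl : IsLagrangian l)
    (φ : ℝ) (x : PhaseSpace n) : l.reflection (rot φ x) = rot (-φ) (l.reflection x) := by
  simp only [rot_apply, map_add, map_smul, hl.reflection_Jmap, Real.cos_neg, Real.sin_neg]
  module

/-- The image of a subspace under `exp(φ J)`. -/
def rotate (φ : ℝ) (l : Submodule ℝ (PhaseSpace n)) : Submodule ℝ (PhaseSpace n) :=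
  l.map (rot (n := n) φ : PhaseSpace n →ₗ[ℝ] PhaseSpace n)

theorem mem_rotate {l : Submodule ℝ (PhaseSpace n)} {φ : ℝ} {x : PhaseSpace n} :
    x ∈ rotate φ l ↔ rot (-φ) x ∈ l := by
  constructor
  · rintro ⟨y, hy, rfl⟩
    simpa [rot_rot] using hy
  · intro h
    exact ⟨_, h, by simp [rot_rot]⟩

/-- Reflection in `l` inverts rotations, so the fixed-point condition for `rot (-φ) x` becomes an
equation with twice the angle. This is why the angle `θ` on the circle corresponds to a rotation by
`θ / 2`. -/
theorem IsLagrangian.mem_rotate_iff {l : Submodule ℝ (PhaseSpace n)} (hl : IsLagrangian l)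
    {φ : ℝ} {x : PhaseSpace n} :
    x ∈ rotate φ l ↔
      l.reflection x = rot (-(2 * φ)) x := by
  rw [mem_rotate, ← Submodule.reflection_eq_self_iff, hl.reflection_rot, neg_neg]
  constructor
  · intro h
    have := congrArg (rot (-φ)) h
    rw [rot_rot, rot_rot] at this
    simpa [two_mul] using this
  · intro h
    rw [h, rot_rot]
    congr 2
    ring_nf

/-! ### The eigenspaces of `W̃` -/

theorem toEuclideanCLM_projMatrix (l : Submodule ℝ (PhaseSpace n)) :
    Matrix.toEuclideanCLM (𝕜 := ℝ) (projMatrix l) = l.starProjection := by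
  rw [projMatrix, StarAlgEquiv.apply_symm_apply]

theorem toEuclideanCLM_wMatrix (l l₁ : Submodule ℝ (PhaseSpace n)) (x : PhaseSpace n) :
    Matrix.toEuclideanCLM (𝕜 := ℝ) (wMatrix l l₁) x = -l.reflection (l₁.reflection x) := by
  have h2 : ∀ A : PhaseMatrix n, ∀ x, Matrix.toEuclideanCLM (𝕜 := ℝ) (2 * A) x =
      2 • Matrix.toEuclideanCLM (𝕜 := ℝ) A x := by
    intro A x
    rw [two_mul, map_add, two_smul, add_apply]
  rw [wMatrix, conjMatrix, map_mul, mul_apply_eq_comp, map_sub, map_sub, map_one, sub_apply,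
    sub_apply, one_apply_eq_self, one_apply_eq_self, h2, h2, toEuclideanCLM_projMatrix,
    toEuclideanCLM_projMatrix, Submodule.reflection_apply, Submodule.reflection_apply]
  abel

/-- The identification `(p, q) ↦ p + i q` of `ℝ²ⁿ` with `ℂⁿ`. -/
def toComplexVec (n : ℕ) : PhaseSpace n ≃ₗ[ℝ] (Fin n → ℂ) where
  toFun x := fun i => ⟨x (Sum.inl i), x (Sum.inr i)⟩
  invFun z := WithLp.toLp 2 (Sum.elim (fun i => (z i).re) (fun i => (z i).im))
  map_add' x y := by ext i; apply Complex.ext <;> simp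
  map_smul' c x := by ext i; apply Complex.ext <;> simp
  left_inv x := by ext (i | i) <;> simp
  right_inv z := by ext i; simp

theorem toComplexVec_Jmap (x : PhaseSpace n) :
    toComplexVec n (Jmap n x) = Complex.I • toComplexVec n x := by
  ext i
  apply Complex.ext <;> simp [toComplexVec]

theorem toComplexVec_rot (φ : ℝ) (x : PhaseSpace n) :
    toComplexVec n (rot φ x) = Complex.exp (Complex.I * (φ : ℂ)) • toComplexVec n x := by
  rw [rot_apply, map_add, map_smul, map_smul, toComplexVec_Jmap, mul_comm Complex.I,
    Complex.exp_mul_I, ← Complex.ofReal_cos, ← Complex.ofReal_sin]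
  ext i
  simp
  ring

/-- Commutation with `J` determines the right-hand blocks of `W` from the left-hand ones, so `W`
acts on `p + i q` as a complex matrix. -/
theorem complexMatrix_mulVec {W : PhaseMatrix n}
    (hW : ∀ x, Matrix.toEuclideanCLM (𝕜 := ℝ) W (Jmap n x) =
      Jmap n (Matrix.toEuclideanCLM (𝕜 := ℝ) W x)) (x : PhaseSpace n) :
    (complexMatrix W).mulVec (toComplexVec n x) =
      toComplexVec n (Matrix.toEuclideanCLM (𝕜 := ℝ) W x) := by
  have key : ∀ i j, W (Sum.inl i) (Sum.inr j) = -W (Sum.inr i) (Sum.inl j) ∧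
      W (Sum.inr i) (Sum.inr j) = W (Sum.inl i) (Sum.inl j) := by
    intro i j
    have h := hW (EuclideanSpace.single (Sum.inl j) 1)
    have hJ : Jmap n (EuclideanSpace.single (Sum.inl j) (1 : ℝ)) =
        EuclideanSpace.single (Sum.inr j) (1 : ℝ) := by
      ext (k | k) <;> simp
    rw [hJ] at h
    have h1 := congrArg (fun v : PhaseSpace n => v (Sum.inl i)) h
    have h2 := congrArg (fun v : PhaseSpace n => v (Sum.inr i)) h
    simp [Matrix.ofLp_toEuclideanCLM] at h1 h2
    exact ⟨h1, h2⟩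
  ext i
  have h1 : Matrix.toEuclideanCLM (𝕜 := ℝ) W x (Sum.inl i) =
      ∑ j, (W (Sum.inl i) (Sum.inl j) * x (Sum.inl j) -
        W (Sum.inr i) (Sum.inl j) * x (Sum.inr j)) := by
    simp [Matrix.ofLp_toEuclideanCLM, Matrix.mulVec, dotProduct, Fintype.sum_sum_type,
      (key _ _).1, sub_eq_add_neg, Finset.sum_add_distrib]
  have h2 : Matrix.toEuclideanCLM (𝕜 := ℝ) W x (Sum.inr i) =
      ∑ j, (W (Sum.inl i) (Sum.inl j) * x (Sum.inr j) +
        W (Sum.inr i) (Sum.inl j) * x (Sum.inl j)) := by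
    simp [Matrix.ofLp_toEuclideanCLM, Matrix.mulVec, dotProduct, Fintype.sum_sum_type,
      (key _ _).2, Finset.sum_add_distrib, add_comm]
  simp only [Matrix.mulVec, dotProduct, toComplexVec, LinearEquiv.coe_mk, LinearMap.coe_mk,
    AddHom.coe_mk, h1, h2, complexMatrix]
  apply Complex.ext
  · simp [Matrix.toBlocks₁₁, Matrix.toBlocks₂₁]
  · simp [Matrix.toBlocks₁₁, Matrix.toBlocks₂₁]

theorem mem_circleEigenspace_wTilde {l l₁ : Submodule ℝ (PhaseSpace n)} (hl : IsLagrangian l)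
    (hl₁ : IsLagrangian l₁) (θ : ℝ) (x : PhaseSpace n) :
    toComplexVec n x ∈ circleEigenspace (wTilde l l₁) θ ↔
      l.reflection (l₁.reflection x) = rot θ x := by
  have hW : ∀ x, Matrix.toEuclideanCLM (𝕜 := ℝ) (wMatrix l l₁) (Jmap n x) =
      Jmap n (Matrix.toEuclideanCLM (𝕜 := ℝ) (wMatrix l l₁) x) := by
    intro x
    simp only [toEuclideanCLM_wMatrix, hl₁.reflection_Jmap, map_neg, hl.reflection_Jmap, neg_neg]
  have hr : rot (Real.pi + θ) x = -rot θ x := by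
    rw [rot_apply, rot_apply, add_comm Real.pi, Real.cos_add_pi, Real.sin_add_pi]
    module
  rw [circleEigenspace, Module.End.mem_eigenspace_iff, Matrix.toLin'_apply, wTilde,
    complexMatrix_mulVec hW, ← toComplexVec_rot, (toComplexVec n).injective.eq_iff,
    toEuclideanCLM_wMatrix, hr, neg_inj]

/-- The eigenspaces of `W̃` measure the intersections of `l` with the rotated target. -/
theorem finrank_circleEigenspace {l l₁ : Submodule ℝ (PhaseSpace n)} (hl : IsLagrangian l)
    (hl₁ : IsLagrangian l₁) (θ : ℝ) :
    Module.finrank ℂ (circleEigenspace (wTilde l l₁) θ) =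
      Module.finrank ℝ (l ⊓ rotate (θ / 2) l₁ : Submodule ℝ (PhaseSpace n)) := by
  set D := l ⊓ rotate (θ / 2) l₁ with hD
  have memD : ∀ x, x ∈ D ↔ l.reflection x = x ∧ l₁.reflection x = rot (-θ) x := by
    intro x
    rw [hD, Submodule.mem_inf, hl₁.mem_rotate_iff, Submodule.reflection_eq_self_iff,
      mul_div_cancel₀ θ two_ne_zero]
  set X := circleEigenspace (wTilde l l₁) θ with hX
  -- The map `(a, b) ↦ a + J b`. It identifies the eigenspace with the complexification of `D`, so
  -- its real dimension is twice that of `D`.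
  let f : (D × D) →ₗ[ℝ] PhaseSpace n :=
    LinearMap.coprod D.subtype ((Jmap n : PhaseSpace n →ₗ[ℝ] PhaseSpace n) ∘ₗ D.subtype)
  let g : (D × D) →ₗ[ℝ] (Fin n → ℂ) := (toComplexVec n).toLinearMap ∘ₗ f
  have hg : Function.Injective g := by
    refine (toComplexVec n).injective.comp ?_
    rw [injective_iff_map_eq_zero]
    rintro ⟨⟨a, ha⟩, ⟨b, hb⟩⟩ h
    have h : a + Jmap n b = 0 := h
    have ha' : a ∈ lᗮ := by
      rw [eq_neg_of_add_eq_zero_left h]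
      exact neg_mem (hl.Jmap_mem_orthogonal hb.1)
    have ha0 : a = 0 := Submodule.disjoint_def.1 (Submodule.orthogonal_disjoint l) a ha.1 ha'
    subst ha0
    rw [zero_add] at h
    have hb0 : b = 0 := Jmap_injective (by rw [h, map_zero])
    subst hb0
    rfl
  have hrange : LinearMap.range g = X.restrictScalars ℝ := by
    ext z
    obtain ⟨x, rfl⟩ := (toComplexVec n).surjective z
    rw [Submodule.restrictScalars_mem, hX, mem_circleEigenspace_wTilde hl hl₁]
    constructor
    · rintro ⟨⟨⟨a, ha⟩, ⟨b, hb⟩⟩, h⟩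
      have h : a + Jmap n b = x := (toComplexVec n).injective h
      have h1 : ∀ a ∈ D, l.reflection (l₁.reflection a) = rot θ a := by
        intro a ha
        rw [memD] at ha
        rw [ha.2, hl.reflection_rot, neg_neg, ha.1]
      rw [← h]
      simp only [map_add, hl₁.reflection_Jmap, map_neg, hl.reflection_Jmap, h1 a ha, h1 b hb,
        rot_Jmap, neg_neg]
    · intro h
      -- Reflection in `l` preserves the eigenspace, is antilinear, and has fixed space `D` there.
      -- So `x` splits into its two symmetric parts, the second being `J` times an element of `D`.
      have h1 : l₁.reflection x = rot (-θ) (l.reflection x) := by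
        rw [← hl.reflection_rot, ← h, Submodule.reflection_reflection]
      have h2 : l₁.reflection (l.reflection x) = rot (-θ) x := by
        have : l.reflection x = rot θ (l₁.reflection x) := by simp [h1, rot_rot]
        rw [this, hl₁.reflection_rot, Submodule.reflection_reflection]
      have ha : (2⁻¹ : ℝ) • (x + l.reflection x) ∈ D := by
        rw [memD]
        constructor
        · simp only [map_smul, map_add, Submodule.reflection_reflection, add_comm]
        · simp only [map_smul, map_add, h1, h2, add_comm]
      have hb : -Jmap n ((2⁻¹ : ℝ) • (x - l.reflection x)) ∈ D := by
        rw [memD]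
        constructor
        · simp only [map_smul, map_sub, map_neg, hl.reflection_Jmap,
            Submodule.reflection_reflection]
          module
        · simp only [map_smul, map_sub, map_neg, hl₁.reflection_Jmap, h1, h2, rot_Jmap]
          module
      refine ⟨⟨⟨_, ha⟩, ⟨_, hb⟩⟩, ?_⟩
      change toComplexVec n ((2⁻¹ : ℝ) • (x + l.reflection x) +
        Jmap n (-Jmap n ((2⁻¹ : ℝ) • (x - l.reflection x)))) = _
      congr 1
      rw [map_neg, Jmap_Jmap, neg_neg]
      module
  have h1 : Module.finrank ℝ (LinearMap.range g) = Module.finrank ℝ D + Module.finrank ℝ D := by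
    rw [LinearMap.finrank_range_of_inj hg, Module.finrank_prod]
  have h2 : Module.finrank ℝ (X.restrictScalars ℝ) = 2 * Module.finrank ℂ X :=
    finrank_real_of_complex X
  rw [hrange, h2] at h1
  omega

/-! ### Inertia of symmetric operators -/

/-- The number, with multiplicity, of the nonnegative eigenvalues of an operator on `ℝⁿ`. -/
def nonnegCount (T : Vec n →ₗ[ℝ] Vec n) : ℕ :=
  ∑ᶠ κ ∈ Set.Ici (0 : ℝ), Module.finrank ℝ (Module.End.eigenspace T κ)

/-- Only finitely many `κ` are eigenvalues, so the `finsum` is a true sum and groups the list of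
eigenvalues by value. -/
theorem nonnegCount_eq_card {T : Vec n →ₗ[ℝ] Vec n} (hT : T.IsSymmetric)
    (hn : Module.finrank ℝ (Vec n) = n) :
    nonnegCount T = (Finset.univ.filter fun i => 0 ≤ hT.eigenvalues hn i).card := by
  set e := hT.eigenvalues hn
  set S := Finset.univ.filter fun i => 0 ≤ e i
  have hcard : ∀ κ : ℝ, Module.finrank ℝ (Module.End.eigenspace T κ) =
      (Finset.univ.filter fun i => e i = κ).card := fun κ =>
    (hT.card_filter_eigenvalues_eq hn κ).symm
  rw [nonnegCount, finsum_mem_eq_sum_of_inter_support_eq (t := S.image e),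
    Finset.card_eq_sum_card_image e S]
  · refine Finset.sum_congr rfl fun κ hκ => ?_
    rw [hcard]
    congr 1
    ext i
    obtain ⟨j, hj, rfl⟩ := Finset.mem_image.1 hκ
    simp only [S, Finset.mem_filter, Finset.mem_univ, true_and] at hj ⊢
    exact ⟨fun h => ⟨h ▸ hj, h⟩, fun h => h.2⟩
  · ext κ
    simp only [Set.mem_inter_iff, Set.mem_Ici, Function.mem_support, Finset.coe_image,
      and_congr_left_iff, hcard]
    intro hκ
    constructor
    · intro h0
      obtain ⟨i, hi⟩ := Finset.card_ne_zero.1 hκ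
      have hi := (Finset.mem_filter.1 hi).2
      exact ⟨i, by simp [S, hi, h0], hi⟩
    · rintro ⟨i, hi, rfl⟩
      simpa [S] using hi

theorem inner_apply_eq_sum_eigenvalues {T : Vec n →ₗ[ℝ] Vec n} (hT : T.IsSymmetric)
    (hn : Module.finrank ℝ (Vec n) = n) (x : Vec n) :
    inner ℝ (T x) x =
      ∑ i, hT.eigenvalues hn i * (inner ℝ (hT.eigenvectorBasis hn i) x) ^ 2 := by
  rw [← (hT.eigenvectorBasis hn).sum_inner_mul_inner]
  refine Finset.sum_congr rfl fun i _ => ?_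
  rw [hT x, hT.apply_eigenvectorBasis, inner_smul_right, real_inner_comm]
  simp
  ring

/-- On the span of the eigenvectors indexed by `s`, the Rayleigh quotient lies between the extreme
eigenvalues of that list. -/
theorem exists_spectral_subspace {T : Vec n →ₗ[ℝ] Vec n} (hT : T.IsSymmetric)
    (hn : Module.finrank ℝ (Vec n) = n) (s : Finset (Fin n)) :
    ∃ P : Submodule ℝ (Vec n), Module.finrank ℝ P = s.card ∧
      (∀ c, (∀ i ∈ s, c ≤ hT.eigenvalues hn i) → ∀ x ∈ P, c * ‖x‖ ^ 2 ≤ inner ℝ (T x) x) ∧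
      (∀ c, (∀ i ∈ s, hT.eigenvalues hn i ≤ c) → ∀ x ∈ P, inner ℝ (T x) x ≤ c * ‖x‖ ^ 2) := by
  set b := hT.eigenvectorBasis hn
  set e := hT.eigenvalues hn
  have hP : ∀ x ∈ Submodule.span ℝ (Set.range fun i : s => b i), ∀ i ∉ s, inner ℝ (b i) x = 0 := by
    intro x hx i hi
    induction hx using Submodule.span_induction with
    | mem x h =>
      obtain ⟨j, rfl⟩ := h
      exact b.orthonormal.2 fun h => hi (h ▸ j.2)
    | zero => simp
    | add x y _ _ h1 h2 => rw [inner_add_right, h1, h2, add_zero]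
    | smul a x _ h => rw [inner_smul_right, h, mul_zero]
  have hnorm : ∀ x, ‖x‖ ^ 2 = ∑ i, (inner ℝ (b i) x) ^ 2 := fun x => by
    rw [← b.sum_sq_norm_inner_right x]
    simp
  refine ⟨Submodule.span ℝ (Set.range fun i : s => b i), ?_, fun c hc x hx => ?_,
    fun c hc x hx => ?_⟩
  · rw [finrank_span_eq_card (b := fun i : s => b i)
      (b.orthonormal.linearIndependent.comp _ Subtype.val_injective)]
    simp
  · rw [inner_apply_eq_sum_eigenvalues hT hn, hnorm, Finset.mul_sum]
    refine Finset.sum_le_sum fun i _ => ?_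
    by_cases hi : i ∈ s
    · exact mul_le_mul_of_nonneg_right (hc i hi) (sq_nonneg _)
    · simp [hP x hx i hi, b]
  · rw [inner_apply_eq_sum_eigenvalues hT hn, hnorm, Finset.mul_sum]
    refine Finset.sum_le_sum fun i _ => ?_
    by_cases hi : i ∈ s
    · exact mul_le_mul_of_nonneg_right (hc i hi) (sq_nonneg _)
    · simp [hP x hx i hi, b]

/-- The subspaces on which a symmetric operator is `≥ 0`, `> 0`, `≤ 0`, and `< 0`. -/
theorem exists_inertia_subspaces {T : Vec n →ₗ[ℝ] Vec n} (hT : T.IsSymmetric) :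
    ∃ P₀ P M₀ M : Submodule ℝ (Vec n), ∃ c : ℝ, 0 < c ∧
      Module.finrank ℝ P₀ = nonnegCount T ∧
      Module.finrank ℝ P + Module.finrank ℝ (LinearMap.ker T) = nonnegCount T ∧
      Module.finrank ℝ M₀ + Module.finrank ℝ P = n ∧
      Module.finrank ℝ M + nonnegCount T = n ∧
      (∀ x ∈ P₀, 0 ≤ inner ℝ (T x) x) ∧ (∀ x ∈ P, c * ‖x‖ ^ 2 ≤ inner ℝ (T x) x) ∧
      (∀ x ∈ M₀, inner ℝ (T x) x ≤ 0) ∧ (∀ x ∈ M, inner ℝ (T x) x ≤ -c * ‖x‖ ^ 2) := by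
  have hn : Module.finrank ℝ (Vec n) = n := by simp
  set e := hT.eigenvalues hn with he
  obtain ⟨P₀, h1, h1', -⟩ := exists_spectral_subspace hT hn (Finset.univ.filter fun i => 0 ≤ e i)
  obtain ⟨P, h2, h2', -⟩ := exists_spectral_subspace hT hn (Finset.univ.filter fun i => 0 < e i)
  obtain ⟨M₀, h3, -, h3'⟩ :=
    exists_spectral_subspace hT hn (Finset.univ.filter fun i => ¬ 0 < e i)
  obtain ⟨M, h4, -, h4'⟩ := exists_spectral_subspace hT hn (Finset.univ.filter fun i => ¬ 0 ≤ e i)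
  -- These are finitely many conditions, each true for small `c > 0`; this also covers the case of
  -- no nonzero eigenvalue.
  obtain ⟨c, hc, hc0⟩ : ∃ c : ℝ, (∀ i, e i ≠ 0 → c ≤ |e i|) ∧ 0 < c := by
    have h : ∀ᶠ c in nhdsWithin (0 : ℝ) (Set.Ioi 0), (∀ i, e i ≠ 0 → c ≤ |e i|) ∧ 0 < c := by
      refine Filter.Eventually.and (Filter.eventually_all.2 fun i => ?_) self_mem_nhdsWithin
      by_cases h0 : e i = 0
      · simp [h0]
      · filter_upwards [mem_nhdsWithin_of_mem_nhds (Iio_mem_nhds (abs_pos.2 h0))] with c hc _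
        exact le_of_lt hc
    exact h.exists
  have hker : Module.finrank ℝ (LinearMap.ker T) = (Finset.univ.filter fun i => e i = 0).card := by
    have := hT.card_filter_eigenvalues_eq hn (0 : ℝ)
    rw [Module.End.eigenspace_zero] at this
    rw [← this]
    simp [he]
  have hcount := nonnegCount_eq_card hT hn
  rw [← he] at hcount
  refine ⟨P₀, P, M₀, M, c, hc0, ?_, ?_, ?_, ?_, ?_, ?_, ?_, ?_⟩
  · rw [h1, hcount]
  · rw [h2, hker, hcount, ← Finset.card_union_of_disjoint]
    · congr 1
      ext i
      simp [le_iff_lt_or_eq, eq_comm]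
    · rw [Finset.disjoint_filter]
      intro i _ h h'
      exact h.ne' h'
  · rw [h2, h3, add_comm, Finset.card_filter_add_card_filter_not]
    simp
  · rw [h4, hcount, add_comm, Finset.card_filter_add_card_filter_not]
    simp
  · intro x hx
    simpa using h1' 0 (by simp [he]) x hx
  · intro x hx
    refine h2' c (fun i hi => ?_) x hx
    have hi : 0 < e i := by simpa using hi
    simpa [abs_of_pos hi] using hc i hi.ne'
  · intro x hx
    simpa using h3' 0 (by simp [he]) x hx
  · intro x hx
    refine h4' (-c) (fun i hi => ?_) x hx
    have hi : e i < 0 := by simpa using hi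
    have := hc i hi.ne
    rw [abs_of_neg hi] at this
    linarith

theorem finrank_add_le_of_inter {P M : Submodule ℝ (Vec n)} (h : ∀ x ∈ P, x ∈ M → x = 0) :
    Module.finrank ℝ P + Module.finrank ℝ M ≤ n := by
  have := Submodule.finrank_add_finrank_le_of_disjoint (Submodule.disjoint_def.2 h)
  simpa using this

/-- Effect on the number of nonnegative eigenvalues of a small definite perturbation. -/
theorem nonnegCount_perturb {T : Vec n →ₗ[ℝ] Vec n} (hT : T.IsSymmetric) :
    ∃ c : ℝ, 0 < c ∧ ∀ T' : Vec n →ₗ[ℝ] Vec n, T'.IsSymmetric →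
      (∀ x, |inner ℝ (T' x) x - inner ℝ (T x) x| ≤ c * ‖x‖ ^ 2) →
      ((∀ x, x ≠ 0 → inner ℝ (T x) x < inner ℝ (T' x) x) → nonnegCount T' = nonnegCount T) ∧
      ((∀ x, x ≠ 0 → inner ℝ (T' x) x < inner ℝ (T x) x) →
        nonnegCount T' + Module.finrank ℝ (LinearMap.ker T) = nonnegCount T) := by
  obtain ⟨P₀, P, M₀, M, c, hc, h1, h2, h3, h4, i1, i2, i3, i4⟩ := exists_inertia_subspaces hT
  -- `c` is the spectral gap of `T` around 0, so a perturbation of size `c / 2` cannot change the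
  -- sign on `P` or `M`. Each bound below comes from two subspaces with incompatible signs, which
  -- meet only in 0: strict comparison `hlt` handles the pairs where `T` is semidefinite, the gap
  -- handles the others.
  refine ⟨c / 2, half_pos hc, fun T' hT' hd => ?_⟩
  obtain ⟨P₀', P', M₀', M', c', hc', h1', h2', h3', h4', j1, j2, j3, j4⟩ :=
    exists_inertia_subspaces hT'
  have hpos : ∀ {x : Vec n} {a : ℝ}, 0 < a → x ≠ 0 → 0 < a * ‖x‖ ^ 2 := fun ha hx =>
    mul_pos ha (pow_pos (norm_pos_iff.2 hx) 2)
  constructor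
  · intro hlt
    have e1 : Module.finrank ℝ P₀ + Module.finrank ℝ M' ≤ n :=
      finrank_add_le_of_inter fun x hx hx' => by
        by_contra h0
        linarith [i1 x hx, j4 x hx', hlt x h0, hpos hc' h0]
    have e2 : Module.finrank ℝ P₀' + Module.finrank ℝ M ≤ n :=
      finrank_add_le_of_inter fun x hx hx' => by
        by_contra h0
        linarith [j1 x hx, i4 x hx', (abs_le.1 (hd x)).2, hpos hc h0]
    omega
  · intro hlt
    have e1 : Module.finrank ℝ P₀' + Module.finrank ℝ M₀ ≤ n :=
      finrank_add_le_of_inter fun x hx hx' => by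
        by_contra h0
        linarith [j1 x hx, i3 x hx', hlt x h0]
    have e2 : Module.finrank ℝ P + Module.finrank ℝ M' ≤ n :=
      finrank_add_le_of_inter fun x hx hx' => by
        by_contra h0
        linarith [i2 x hx, j4 x hx', (abs_le.1 (hd x)).1, hpos hc h0, hpos hc' h0]
    omega

/-! ### Lagrangian subspaces as graphs -/

theorem IsLagrangian.exists_isometry {l : Submodule ℝ (PhaseSpace n)} (hl : IsLagrangian l) :
    ∃ u : Vec n →ₗᵢ[ℝ] PhaseSpace n, LinearMap.range u.toLinearMap = l := by
  let b := (stdOrthonormalBasis ℝ l).reindex (finCongr hl.1)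
  refine ⟨l.subtypeₗᵢ.comp b.repr.symm.toLinearIsometry, ?_⟩
  ext x
  constructor
  · rintro ⟨y, rfl⟩
    exact (b.repr.symm y).2
  · intro hx
    exact ⟨b.repr ⟨x, hx⟩, by simp⟩

section Graph

variable (u : Vec n →ₗᵢ[ℝ] PhaseSpace n) (φ : ℝ)

/-- The second component in the decomposition of `ℝ²ⁿ` into the range of `u` and its rotation
by the angle `φ`. -/
def graphSnd : PhaseSpace n →L[ℝ] Vec n :=
  -((Real.sin φ)⁻¹ • (ContinuousLinearMap.adjoint u.toContinuousLinearMap ∘L Jmap n))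

/-- The first component in the decomposition of `ℝ²ⁿ` into the range of `u` and its rotation
by the angle `φ`. -/
def graphFst : PhaseSpace n →L[ℝ] Vec n :=
  ContinuousLinearMap.adjoint u.toContinuousLinearMap - Real.cos φ • graphSnd u φ

variable {u φ}

theorem adjoint_apply_self (a : Vec n) :
    ContinuousLinearMap.adjoint u.toContinuousLinearMap (u a) = a := by
  refine ext_inner_left ℝ fun b => ?_
  rw [ContinuousLinearMap.adjoint_inner_right]
  exact u.inner_map_map b a

theorem adjoint_apply_Jmap (hu : IsLagrangian (LinearMap.range u.toLinearMap)) (a : Vec n) :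
    ContinuousLinearMap.adjoint u.toContinuousLinearMap (Jmap n (u a)) = 0 := by
  refine ext_inner_left ℝ fun b => ?_
  rw [ContinuousLinearMap.adjoint_inner_right, inner_zero_right, real_inner_comm]
  exact hu.2 _ ⟨a, rfl⟩ _ ⟨b, rfl⟩

/-- The adjoint of `u` composed with `J` kills the Lagrangian range of `u`, and on the rotated copy
it leaves `-sin φ • b`. -/
theorem graphSnd_apply (hu : IsLagrangian (LinearMap.range u.toLinearMap)) (hφ : Real.sin φ ≠ 0)
    (a b : Vec n) : graphSnd u φ (u a + rot φ (u b)) = b := by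
  simp only [graphSnd, rot_apply, neg_apply, smul_apply, ContinuousLinearMap.comp_apply, map_add,
    map_smul, Jmap_Jmap, map_neg, adjoint_apply_Jmap hu, adjoint_apply_self]
  match_scalars
  field_simp

theorem graphFst_apply (hu : IsLagrangian (LinearMap.range u.toLinearMap)) (hφ : Real.sin φ ≠ 0)
    (a b : Vec n) : graphFst u φ (u a + rot φ (u b)) = a := by
  rw [graphFst, sub_apply, smul_apply, graphSnd_apply hu hφ]
  simp only [rot_apply, map_add, map_smul, adjoint_apply_Jmap hu, adjoint_apply_self]
  module

theorem graph_decomp (hu : IsLagrangian (LinearMap.range u.toLinearMap)) (hφ : Real.sin φ ≠ 0)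
    (v : PhaseSpace n) : u (graphFst u φ v) + rot φ (u (graphSnd u φ v)) = v := by
  obtain ⟨a, b, rfl⟩ : ∃ a b, v = u a + rot φ (u b) := by
    have h1 := Submodule.starProjection_apply_mem (LinearMap.range u.toLinearMap) v
    have h2 := Submodule.sub_starProjection_mem_orthogonal (K := LinearMap.range u.toLinearMap) v
    rw [← hu.map_Jmap] at h2
    obtain ⟨a, ha⟩ := h1
    obtain ⟨_, ⟨b, rfl⟩, hb⟩ := h2
    change u a = _ at ha
    change Jmap n (u b) = _ at hb
    rw [← ha] at hb
    refine ⟨a - (Real.cos φ / Real.sin φ) • b, (Real.sin φ)⁻¹ • b, ?_⟩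
    rw [eq_sub_iff_add_eq'] at hb
    rw [← hb, rot_apply]
    simp only [map_sub, map_smul, smul_smul, mul_inv_cancel₀ hφ, one_smul, div_eq_mul_inv]
    module
  rw [graphFst_apply hu hφ, graphSnd_apply hu hφ]

/-- Both summands are Lagrangian, so only the mixed terms survive. A graph is therefore isotropic
exactly when its operator is symmetric, and `omega` between two graphs compares their operators. -/
theorem omega_graph (hu : IsLagrangian (LinearMap.range u.toLinearMap)) (a a' b b' : Vec n) :
    omega (u a + rot φ (u a')) (u b + rot φ (u b')) =
      Real.sin φ * (inner ℝ a b' - inner ℝ a' b) := by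
  have h0 : ∀ x y, inner ℝ (Jmap n (u x)) (u y) = 0 := fun x y => hu.2 _ ⟨x, rfl⟩ _ ⟨y, rfl⟩
  rw [omega_eq_inner, map_add, inner_add_left, inner_add_right, inner_add_right, h0,
    ← rot_Jmap, inner_rot_rot, h0, rot_apply, rot_apply]
  simp only [inner_add_left, inner_add_right, inner_smul_left, inner_smul_right, h0, Jmap_Jmap,
    inner_Jmap_Jmap, inner_neg_left, u.inner_map_map, conj_trivial]
  ring

variable (u φ) in
/-- The operator whose graph, in the decomposition of `ℝ²ⁿ` into the range of `u` and its rotation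
by the angle `φ`, is the range of `F`. -/
def graphOp (F : Vec n →L[ℝ] PhaseSpace n) : Vec n →L[ℝ] Vec n :=
  (graphSnd u φ ∘L F) * Ring.inverse (graphFst u φ ∘L F)

theorem isUnit_of_injective {T : Vec n →L[ℝ] Vec n} (hT : Function.Injective T) : IsUnit T := by
  rw [ContinuousLinearMap.isUnit_iff_bijective]
  exact ⟨hT, (LinearMap.injective_iff_surjective (f := (T : Vec n →ₗ[ℝ] Vec n))).1 hT⟩

/-- The kernel of the first coordinate on the range of `F` is its intersection with the rotated
target. -/
theorem isUnit_graphFst_comp (hu : IsLagrangian (LinearMap.range u.toLinearMap))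
    (hφ : Real.sin φ ≠ 0) {F : Vec n →L[ℝ] PhaseSpace n} (hF : Function.Injective F)
    (h : LinearMap.range F.toLinearMap ⊓ rotate φ (LinearMap.range u.toLinearMap) = ⊥) :
    IsUnit (graphFst u φ ∘L F) := by
  apply isUnit_of_injective
  rw [injective_iff_map_eq_zero]
  intro a ha
  have h1 := graph_decomp hu hφ (F a)
  rw [show graphFst u φ (F a) = 0 from ha, map_zero, zero_add] at h1
  have h2 : F a ∈ LinearMap.range F.toLinearMap ⊓ rotate φ (LinearMap.range u.toLinearMap) :=
    ⟨⟨a, rfl⟩, ⟨_, ⟨_, rfl⟩, h1⟩⟩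
  rw [h, Submodule.mem_bot] at h2
  exact hF (by rw [h2, map_zero])

theorem apply_inverse_graphFst (hu : IsLagrangian (LinearMap.range u.toLinearMap))
    (hφ : Real.sin φ ≠ 0) {F : Vec n →L[ℝ] PhaseSpace n} (hX : IsUnit (graphFst u φ ∘L F))
    (a : Vec n) :
    F (Ring.inverse (graphFst u φ ∘L F) a) = u a + rot φ (u (graphOp u φ F a)) := by
  have h1 := graph_decomp hu hφ (F (Ring.inverse (graphFst u φ ∘L F) a))
  have h2 : graphFst u φ (F (Ring.inverse (graphFst u φ ∘L F) a)) = a := by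
    have := congrArg (fun T : Vec n →L[ℝ] Vec n => T a) (Ring.mul_inverse_cancel _ hX)
    exact this
  rw [h2] at h1
  exact h1.symm

theorem omega_apply_inverse (hu : IsLagrangian (LinearMap.range u.toLinearMap))
    (hφ : Real.sin φ ≠ 0) {F F' : Vec n →L[ℝ] PhaseSpace n} (hX : IsUnit (graphFst u φ ∘L F))
    (hX' : IsUnit (graphFst u φ ∘L F')) (a b : Vec n) :
    omega (F (Ring.inverse (graphFst u φ ∘L F) a)) (F' (Ring.inverse (graphFst u φ ∘L F') b)) =
      Real.sin φ * (inner ℝ a (graphOp u φ F' b) - inner ℝ (graphOp u φ F a) b) := by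
  rw [apply_inverse_graphFst hu hφ hX, apply_inverse_graphFst hu hφ hX', omega_graph hu]

theorem graphOp_isSymmetric (hu : IsLagrangian (LinearMap.range u.toLinearMap))
    (hφ : Real.sin φ ≠ 0) {F : Vec n →L[ℝ] PhaseSpace n} (hX : IsUnit (graphFst u φ ∘L F))
    (hF : ∀ x y, omega (F x) (F y) = 0) :
    (graphOp u φ F : Vec n →ₗ[ℝ] Vec n).IsSymmetric := by
  intro a b
  have h := omega_apply_inverse hu hφ hX hX a b
  rw [hF] at h
  have := (mul_eq_zero.1 h.symm).resolve_left hφ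
  exact (sub_eq_zero.1 this).symm

/-- Since `rot ψ = sin (φ - ψ) / sin φ + (sin ψ / sin φ) • rot φ`, the vector `rot ψ (u g)` lies on
the graph of `N` iff `N g` is the stated ratio times `g`. For `ψ = 0` this computes the kernel of
`N`. -/
theorem finrank_inf_rotate (hu : IsLagrangian (LinearMap.range u.toLinearMap))
    (hφ : Real.sin φ ≠ 0) {F : Vec n →L[ℝ] PhaseSpace n} (hX : IsUnit (graphFst u φ ∘L F))
    {ψ : ℝ} (hψ : Real.sin (φ - ψ) ≠ 0) :
    Module.finrank ℝ (LinearMap.range F.toLinearMap ⊓ rotate ψ (LinearMap.range u.toLinearMap) :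
      Submodule ℝ (PhaseSpace n)) =
    Module.finrank ℝ (Module.End.eigenspace (graphOp u φ F : Vec n →ₗ[ℝ] Vec n)
      (Real.sin ψ / Real.sin (φ - ψ))) := by
  set N := graphOp u φ F with hN
  set G : Vec n →L[ℝ] PhaseSpace n := F ∘L Ring.inverse (graphFst u φ ∘L F) with hG
  have hGa : ∀ a, G a = u a + rot φ (u (N a)) := apply_inverse_graphFst hu hφ hX
  have hfst : ∀ a, graphFst u φ (G a) = a := fun a => by rw [hGa, graphFst_apply hu hφ]
  have hinj : Function.Injective G.toLinearMap := Function.LeftInverse.injective hfst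
  have hrange : ∀ x, F x = G (graphFst u φ (F x)) := fun x => by
    have := congrArg (fun T : Vec n →L[ℝ] Vec n => F (T x)) (Ring.inverse_mul_cancel _ hX)
    exact this.symm
  rw [← finrank_map_of_injective hinj]
  suffices h : LinearMap.range F.toLinearMap ⊓ rotate ψ (LinearMap.range u.toLinearMap) =
      (Module.End.eigenspace (N : Vec n →ₗ[ℝ] Vec n)
        (Real.sin ψ / Real.sin (φ - ψ))).map G.toLinearMap by rw [h]
  have hs : Real.sin (φ - ψ) = Real.sin φ * Real.cos ψ - Real.cos φ * Real.sin ψ :=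
    Real.sin_sub φ ψ
  ext x
  rw [Submodule.mem_inf, Submodule.mem_map]
  constructor
  · rintro ⟨⟨y, rfl⟩, ⟨_, ⟨g, rfl⟩, hg⟩⟩
    refine ⟨graphFst u φ (F y), ?_, (hrange y).symm⟩
    have hg : rot ψ (u g) = F y := hg
    set a := graphFst u φ (F y) with ha
    have h1 : F y = u a + rot φ (u (N a)) := by rw [hrange y, hGa]
    have h2 : F y = u ((Real.sin (φ - ψ) / Real.sin φ) • g) +
        rot φ (u ((Real.sin ψ / Real.sin φ) • g)) := by
      rw [← hg, rot_apply, rot_apply]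
      simp only [map_smul]
      match_scalars
      · rw [hs]
        field_simp
        ring
      · field_simp
    have h3 : a = (Real.sin (φ - ψ) / Real.sin φ) • g := by
      rw [ha, h2, graphFst_apply hu hφ]
    have h4 : N a = (Real.sin ψ / Real.sin φ) • g := by
      rw [← graphSnd_apply hu hφ a (N a), ← h1, h2, graphSnd_apply hu hφ]
    rw [Module.End.mem_eigenspace_iff]
    change N a = _
    rw [h4, h3, smul_smul]
    congr 1
    field_simp
  · rintro ⟨a, ha, rfl⟩
    rw [Module.End.mem_eigenspace_iff] at ha
    have ha : N a = _ := ha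
    refine ⟨⟨_, rfl⟩, ⟨_, ⟨(Real.sin φ / Real.sin (φ - ψ)) • a, rfl⟩, ?_⟩⟩
    change rot ψ (u _) = G a
    rw [hGa, ha, rot_apply, rot_apply]
    simp only [map_smul]
    match_scalars
    · field_simp
      rw [hs]
      ring
    · field_simp

/-- The ratio goes from 0 to infinity, its denominator vanishing at `θ = ε`. Surjectivity uses the
equation cleared of denominators, which is continuous up to `ε`, and the intermediate value theorem.
-/
theorem bijOn_sin_div_sin {ε : ℝ} (hε : ε ∈ Set.Ioo 0 Real.pi) :
    Set.BijOn (fun θ => Real.sin (θ / 2) / Real.sin (ε / 2 - θ / 2)) (Set.Ico 0 ε)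
      (Set.Ici 0) := by
  obtain ⟨h0, hpi⟩ := hε
  have hpos : ∀ θ ∈ Set.Ico 0 ε, 0 < Real.sin (ε / 2 - θ / 2) := fun θ hθ =>
    Real.sin_pos_of_pos_of_lt_pi (by linarith [hθ.2]) (by linarith [hθ.1])
  refine ⟨fun θ hθ => ?_, fun θ hθ η hη h => ?_, fun κ hκ => ?_⟩
  · exact div_nonneg (Real.sin_nonneg_of_nonneg_of_le_pi (by linarith [hθ.1])
      (by linarith [hθ.2])) (hpos θ hθ).le
  · have h := (div_eq_div_iff (hpos θ hθ).ne' (hpos η hη).ne').1 h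
    have h1 : Real.sin (ε / 2) * Real.sin (θ / 2 - η / 2) = 0 := by
      rw [Real.sin_sub, Real.sin_sub] at h
      rw [Real.sin_sub]
      linear_combination h
    have h2 : Real.sin (θ / 2 - η / 2) = 0 :=
      (mul_eq_zero.1 h1).resolve_left
        (Real.sin_pos_of_pos_of_lt_pi (by linarith) (by linarith)).ne'
    rw [Real.sin_eq_zero_iff_of_lt_of_lt (by linarith [hθ.1, hη.2]) (by linarith [hθ.2, hη.1])]
      at h2
    linarith
  · have hs : 0 < Real.sin (ε / 2) := Real.sin_pos_of_pos_of_lt_pi (by linarith) (by linarith)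
    have hcont : ContinuousOn
        (fun θ => Real.sin (θ / 2) - κ * Real.sin (ε / 2 - θ / 2)) (Set.Icc 0 ε) := by fun_prop
    obtain ⟨θ, hθ, h⟩ := intermediate_value_Icc h0.le hcont (show (0 : ℝ) ∈ Set.Icc _ _ by
      simp only [zero_div, Real.sin_zero, sub_zero, zero_sub, sub_self, mul_zero]
      exact ⟨neg_nonpos.2 (mul_nonneg hκ hs.le), hs.le⟩)
    have hne : θ ≠ ε := by
      rintro rfl
      simp only [sub_self, Real.sin_zero, mul_zero, sub_zero] at h
      exact hs.ne' h
    have hθ' : θ ∈ Set.Ico 0 ε := ⟨hθ.1, lt_of_le_of_ne hθ.2 hne⟩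
    refine ⟨θ, hθ', ?_⟩
    rw [div_eq_iff (hpos θ hθ').ne']
    exact sub_eq_zero.1 h

/-- The number of the eigenvalues of `W̃` on an arc as an inertia index. -/
theorem arcCount_eq_nonnegCount (hu : IsLagrangian (LinearMap.range u.toLinearMap))
    {ε : ℝ} (hε : ε ∈ Set.Ioo 0 Real.pi) {F : Vec n →L[ℝ] PhaseSpace n}
    (hl : IsLagrangian (LinearMap.range F.toLinearMap))
    (hX : IsUnit (graphFst u (ε / 2) ∘L F)) :
    arcCount (wTilde (LinearMap.range F.toLinearMap) (LinearMap.range u.toLinearMap)) ε =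
      nonnegCount (graphOp u (ε / 2) F).toLinearMap := by
  have hs : Real.sin (ε / 2) ≠ 0 :=
    (Real.sin_pos_of_pos_of_lt_pi (by linarith [hε.1]) (by linarith [hε.1, hε.2])).ne'
  refine finsum_mem_eq_of_bijOn _ (bijOn_sin_div_sin hε) fun θ hθ => ?_
  rw [finrank_circleEigenspace hl hu, finrank_inf_rotate hu hs hX]
  exact (Real.sin_pos_of_pos_of_lt_pi (by linarith [hθ.2])
    (by linarith [hθ.1, hε.2, hε.1])).ne'

end Graph

/-! ### Linear differential equations on the unit interval -/

section Volterra

variable {E : Type*} [NormedAddCommGroup E]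

/-- The extension of a function on `[0, 1]` to `ℝ` which is constant on both sides. -/
def extendUnit (f : C(Set.Icc (0 : ℝ) 1, E)) : ℝ → E := Set.IccExtend zero_le_one f

theorem continuous_extendUnit (f : C(Set.Icc (0 : ℝ) 1, E)) : Continuous (extendUnit f) :=
  f.continuous.Icc_extend'

theorem extendUnit_of_mem (f : C(Set.Icc (0 : ℝ) 1, E)) {x : ℝ} (hx : x ∈ Set.Icc (0 : ℝ) 1) :
    extendUnit f x = f ⟨x, hx⟩ := Set.IccExtend_of_mem _ _ hx

theorem norm_extendUnit_le (f : C(Set.Icc (0 : ℝ) 1, E)) (x : ℝ) : ‖extendUnit f x‖ ≤ ‖f‖ :=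
  f.norm_coe_le_norm _

variable [NormedSpace ℝ E]

theorem continuous_volterraIntegrand (A : C(ℝ, E →L[ℝ] E)) (f : C(Set.Icc (0 : ℝ) 1, E)) :
    Continuous fun t => A t (extendUnit f t) :=
  A.continuous.clm_apply (continuous_extendUnit f)

theorem exists_norm_le_of_continuousMap {F : Type*} [NormedAddCommGroup F] (A : C(ℝ, F)) :
    ∃ M : ℝ, 0 ≤ M ∧ ∀ t ∈ Set.Icc (0 : ℝ) 1, ‖A t‖ ≤ M := by
  obtain ⟨M, hM⟩ := isCompact_Icc.exists_bound_of_continuousOn (A.continuous.continuousOn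
    (s := Set.Icc (0 : ℝ) 1))
  exact ⟨max M 0, le_max_right _ _, fun t ht => (hM t ht).trans (le_max_left _ _)⟩

/-- The operator `f ↦ ∫₀ˣ A(t) f(t) dt` on the continuous functions on `[0, 1]`, as a function. -/
def volterraFun (A : C(ℝ, E →L[ℝ] E)) (f : C(Set.Icc (0 : ℝ) 1, E)) : C(Set.Icc (0 : ℝ) 1, E) where
  toFun x := ∫ t in (0 : ℝ)..x, A t (extendUnit f t)
  continuous_toFun := (intervalIntegral.continuous_primitive
    (fun _ _ => (continuous_volterraIntegrand A f).intervalIntegrable _ _) 0).comp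
      continuous_subtype_val

theorem volterraFun_apply (A : C(ℝ, E →L[ℝ] E)) (f : C(Set.Icc (0 : ℝ) 1, E))
    (x : Set.Icc (0 : ℝ) 1) : volterraFun A f x = ∫ t in (0 : ℝ)..x, A t (extendUnit f t) := rfl

/-- The induction step for the factorial bound: `M (M t)^k / k!` integrates to `(M x)^(k+1) /
(k+1)!`. The case `k = 0` gives boundedness of the operator. -/
theorem norm_volterraFun_apply_le {A : C(ℝ, E →L[ℝ] E)} {M : ℝ} (hM0 : 0 ≤ M)
    (hM : ∀ t ∈ Set.Icc (0 : ℝ) 1, ‖A t‖ ≤ M) {C : ℝ} {k : ℕ} {f : C(Set.Icc (0 : ℝ) 1, E)}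
    (hf : ∀ x : Set.Icc (0 : ℝ) 1, ‖f x‖ ≤ (M * x) ^ k / k.factorial * C)
    (x : Set.Icc (0 : ℝ) 1) :
    ‖volterraFun A f x‖ ≤ (M * x) ^ (k + 1) / (k + 1).factorial * C := by
  have h : ∀ t ∈ Set.Ioc (0 : ℝ) x,
      ‖A t (extendUnit f t)‖ ≤ M * ((M * t) ^ k / k.factorial * C) := by
    intro t ht
    have ht' : t ∈ Set.Icc (0 : ℝ) 1 := ⟨ht.1.le, ht.2.trans x.2.2⟩
    refine (ContinuousLinearMap.le_opNorm _ _).trans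
      (mul_le_mul (hM t ht') ?_ (norm_nonneg _) hM0)
    rw [extendUnit_of_mem f ht']
    exact hf ⟨t, ht'⟩
  refine (intervalIntegral.norm_integral_le_of_norm_le x.2.1
    (Filter.Eventually.of_forall fun t ht => h t ht)
    (Continuous.intervalIntegrable (by fun_prop) _ _)).trans (le_of_eq ?_)
  have : ∀ t : ℝ, M * ((M * t) ^ k / k.factorial * C) =
      (M ^ (k + 1) / k.factorial * C) * t ^ k := fun t => by rw [mul_pow]; ring
  simp only [this]
  rw [intervalIntegral.integral_const_mul, integral_pow, Nat.factorial_succ]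
  have := Nat.factorial_ne_zero k
  push_cast
  field_simp
  rw [zero_pow (Nat.succ_ne_zero k), sub_zero, mul_pow]
  ring

/-- The operator `f ↦ ∫₀ˣ A(t) f(t) dt` on the continuous functions on `[0, 1]`. -/
def volterra (A : C(ℝ, E →L[ℝ] E)) : C(Set.Icc (0 : ℝ) 1, E) →L[ℝ] C(Set.Icc (0 : ℝ) 1, E) :=
  LinearMap.mkContinuousOfExistsBound
    { toFun := volterraFun A
      map_add' := fun f g => by
        ext x
        rw [ContinuousMap.add_apply, volterraFun_apply, volterraFun_apply, volterraFun_apply,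
          ← intervalIntegral.integral_add
            ((continuous_volterraIntegrand A f).intervalIntegrable _ _)
            ((continuous_volterraIntegrand A g).intervalIntegrable _ _)]
        refine intervalIntegral.integral_congr fun t _ => ?_
        exact map_add (A t) _ _
      map_smul' := fun c f => by
        ext x
        rw [ContinuousMap.smul_apply, volterraFun_apply, volterraFun_apply, RingHom.id_apply,
          ← intervalIntegral.integral_smul]
        refine intervalIntegral.integral_congr fun t _ => ?_
        exact map_smul (A t) _ _ }
    (by
      obtain ⟨M, hM0, hM⟩ := exists_norm_le_of_continuousMap A
      refine ⟨M, fun f => ?_⟩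
      rw [ContinuousMap.norm_le _ (by positivity)]
      intro x
      have := norm_volterraFun_apply_le (k := 0) hM0 hM (C := ‖f‖) (f := f)
        (fun x => by simpa using f.norm_coe_le_norm x) x
      refine this.trans ?_
      simp only [zero_add, pow_one, Nat.factorial_one, Nat.cast_one, div_one]
      exact mul_le_mul_of_nonneg_right (mul_le_of_le_one_right hM0 x.2.2) (norm_nonneg _))

theorem volterra_apply (A : C(ℝ, E →L[ℝ] E)) (f : C(Set.Icc (0 : ℝ) 1, E))
    (x : Set.Icc (0 : ℝ) 1) : volterra A f x = ∫ t in (0 : ℝ)..x, A t (extendUnit f t) := rfl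

theorem volterra_add_smul (A B : C(ℝ, E →L[ℝ] E)) (c : ℝ) :
    volterra (A + c • B) = volterra A + c • volterra B := by
  ext f x
  rw [add_apply, smul_apply, ContinuousMap.add_apply, ContinuousMap.smul_apply, volterra_apply,
    volterra_apply, volterra_apply, ← intervalIntegral.integral_smul,
    ← intervalIntegral.integral_add (g := fun t => c • B t (extendUnit f t))
      ((continuous_volterraIntegrand A f).intervalIntegrable _ _)
      (((continuous_volterraIntegrand B f).const_smul c).intervalIntegrable _ _)]
  rfl

theorem norm_volterra_pow_le {A : C(ℝ, E →L[ℝ] E)} {M : ℝ} (hM0 : 0 ≤ M)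
    (hM : ∀ t ∈ Set.Icc (0 : ℝ) 1, ‖A t‖ ≤ M) (k : ℕ) :
    ‖volterra A ^ k‖ ≤ M ^ k / k.factorial := by
  have h : ∀ (k : ℕ) (f : C(Set.Icc (0 : ℝ) 1, E)) (x : Set.Icc (0 : ℝ) 1),
      ‖(volterra A ^ k) f x‖ ≤ (M * x) ^ k / k.factorial * ‖f‖ := by
    intro k f
    induction k with
    | zero => exact fun x => by simpa using f.norm_coe_le_norm x
    | succ k ih =>
      intro x
      rw [pow_succ', mul_apply_eq_comp]
      exact norm_volterraFun_apply_le hM0 hM ih x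
  refine ContinuousLinearMap.opNorm_le_bound _ (by positivity) fun f => ?_
  rw [ContinuousMap.norm_le _ (by positivity)]
  intro x
  refine (h k f x).trans ?_
  have : M * x ≤ M := mul_le_of_le_one_right hM0 x.2.2
  have hx : 0 ≤ M * x := mul_nonneg hM0 x.2.1
  gcongr

/-- The constant functions on `[0, 1]`. -/
def constUnit (E : Type*) [NormedAddCommGroup E] [NormedSpace ℝ E] :
    E →L[ℝ] C(Set.Icc (0 : ℝ) 1, E) :=
  LinearMap.mkContinuous
    { toFun := ContinuousMap.const _
      map_add' := fun _ _ => rfl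
      map_smul' := fun _ _ => rfl } 1
    (fun v => by
      rw [ContinuousMap.norm_le _ (by positivity)]
      intro x
      exact (one_mul ‖v‖).ge)

theorem constUnit_apply (v : E) (x : Set.Icc (0 : ℝ) 1) : constUnit E v x = v := rfl

/-- The solution on `[0, 1]` of `y' = A y` as a function of its initial value `y(0)`. -/
def solOp (A : C(ℝ, E →L[ℝ] E)) : E →L[ℝ] C(Set.Icc (0 : ℝ) 1, E) :=
  Ring.inverse (1 - volterra A) ∘L constUnit E

/-- The solution of `y' = A y` with initial value `v`, extended to `ℝ` as a differentiable
function. -/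
def solFun (A : C(ℝ, E →L[ℝ] E)) (v : E) (x : ℝ) : E :=
  v + ∫ t in (0 : ℝ)..x, A t (extendUnit (solOp A v) t)

theorem solFun_zero (A : C(ℝ, E →L[ℝ] E)) (v : E) : solFun A v 0 = v := by simp [solFun]

theorem continuous_solFun (A : C(ℝ, E →L[ℝ] E)) (v : E) : Continuous (solFun A v) :=
  continuous_const.add (intervalIntegral.continuous_primitive
    (fun _ _ => (continuous_volterraIntegrand A _).intervalIntegrable _ _) 0)

theorem HasWeakDeriv.continuousOn {u g : ℝ → E} (h : HasWeakDeriv 1 u g) :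
    ContinuousOn u (Set.Icc 0 1) := by
  have h1 : ContinuousOn (fun x => u 0 + ∫ t in (0 : ℝ)..x, g t) (Set.Icc 0 1) := by
    refine continuousOn_const.add ?_
    have := intervalIntegral.continuousOn_primitive_interval (a := 0) (b := 1) (f := g)
      (μ := volume) (by rw [Set.uIcc_of_le zero_le_one]; exact h.1.integrable one_le_two)
    rwa [Set.uIcc_of_le zero_le_one] at this
  exact h1.congr h.2

variable [CompleteSpace E]

/-- The norm of `K = volterra A` may exceed 1, but that of `K ^ k` is eventually below 1. Then `1 -
K ^ k` is invertible, and it is the product of `1 - K` and a geometric sum commuting with it. -/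
theorem isUnit_one_sub_volterra (A : C(ℝ, E →L[ℝ] E)) : IsUnit (1 - volterra A) := by
  obtain ⟨M, hM0, hM⟩ := exists_norm_le_of_continuousMap A
  obtain ⟨k, hk⟩ := ((FloorSemiring.tendsto_pow_div_factorial_atTop M).eventually
    (gt_mem_nhds one_pos)).exists
  have h1 : IsUnit (1 - volterra A ^ k) :=
    isUnit_one_sub_of_norm_lt_one (R := C(Set.Icc (0 : ℝ) 1, E) →L[ℝ] C(Set.Icc (0 : ℝ) 1, E))
      ((norm_volterra_pow_le hM0 hM k).trans_lt hk)
  rw [← mul_neg_geom_sum] at h1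
  refine ((Commute.isUnit_mul_iff ?_).1 h1).1
  refine Commute.sub_left (Commute.one_left _) ?_
  exact Commute.sum_right _ _ _ fun i _ => (Commute.refl _).pow_right i

/-- Existence and uniqueness at once, by inverting `1 - volterra A` in the integral equation. -/
theorem solOp_eq_iff {A : C(ℝ, E →L[ℝ] E)} {v : E} {f : C(Set.Icc (0 : ℝ) 1, E)} :
    solOp A v = f ↔ ∀ x : Set.Icc (0 : ℝ) 1, f x = v + ∫ t in (0 : ℝ)..x, A t (extendUnit f t) := by
  have h1 : (1 - volterra A) f = constUnit E v ↔
      ∀ x : Set.Icc (0 : ℝ) 1, f x = v + ∫ t in (0 : ℝ)..x, A t (extendUnit f t) := by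
    rw [ContinuousMap.ext_iff]
    refine forall_congr' fun x => ?_
    rw [sub_apply, one_apply_eq_self, ContinuousMap.sub_apply, constUnit_apply, volterra_apply,
      sub_eq_iff_eq_add]
  rw [← h1]
  have hU := isUnit_one_sub_volterra A
  constructor
  · rintro rfl
    exact congrArg (fun T : C(Set.Icc (0 : ℝ) 1, E) →L[ℝ] C(Set.Icc (0 : ℝ) 1, E) =>
      T (constUnit E v)) (Ring.mul_inverse_cancel _ hU)
  · intro h
    rw [solOp, ContinuousLinearMap.comp_apply, ← h]
    exact congrArg (fun T : C(Set.Icc (0 : ℝ) 1, E) →L[ℝ] C(Set.Icc (0 : ℝ) 1, E) =>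
      T f) (Ring.inverse_mul_cancel _ hU)

/-- `volterra` is affine in the parameter and inversion is continuous at units, so solutions depend
continuously on the parameter in operator norm. -/
theorem continuous_solOp (A B : C(ℝ, E →L[ℝ] E)) :
    Continuous fun c : ℝ => solOp (A + c • B) := by
  unfold solOp
  simp only [volterra_add_smul]
  refine Continuous.clm_comp (continuous_iff_continuousAt.2 fun c => ?_) continuous_const
  obtain ⟨U, hU⟩ := isUnit_one_sub_volterra (A + c • B)
  rw [volterra_add_smul] at hU
  refine ContinuousAt.comp (g := Ring.inverse) (f := fun c : ℝ => 1 - (volterra A + c • volterra B))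
    ?_ (by fun_prop)
  rw [← hU]
  exact NormedRing.inverse_continuousAt 
    (R := C(Set.Icc (0 : ℝ) 1, E) →L[ℝ] C(Set.Icc (0 : ℝ) 1, E)) U

theorem solFun_eq (A : C(ℝ, E →L[ℝ] E)) (v : E) {x : ℝ} (hx : x ∈ Set.Icc (0 : ℝ) 1) :
    solFun A v x = solOp A v ⟨x, hx⟩ :=
  (solOp_eq_iff.1 rfl ⟨x, hx⟩).symm

theorem hasDerivAt_solFun (A : C(ℝ, E →L[ℝ] E)) (v : E) {x : ℝ} (hx : x ∈ Set.Icc (0 : ℝ) 1) :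
    HasDerivAt (solFun A v) (A x (solFun A v x)) x := by
  have hc := continuous_volterraIntegrand A (solOp A v)
  have h := (hc.integral_hasStrictDerivAt 0 x).hasDerivAt.const_add v
  rw [solFun_eq A v hx, ← extendUnit_of_mem]
  exact h

theorem hasWeakDeriv_solFun (A : C(ℝ, E →L[ℝ] E)) (v : E) :
    HasWeakDeriv 1 (solFun A v) (fun x => A x (solFun A v x)) := by
  have hc : Continuous fun x => A x (solFun A v x) := A.continuous.clm_apply (continuous_solFun A v)
  refine ⟨?_, fun x hx => ?_⟩
  · obtain ⟨M, -, hM⟩ := exists_norm_le_of_continuousMap ⟨_, hc⟩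
    exact MemLp.of_bound hc.aestronglyMeasurable M
      ((ae_restrict_iff' measurableSet_Icc).2 (Filter.Eventually.of_forall hM))
  · rw [intervalIntegral.integral_eq_sub_of_hasDerivAt (f := solFun A v) _
      (hc.intervalIntegrable _ _)]
    · abel
    · intro t ht
      rw [Set.uIcc_of_le hx.1] at ht
      exact hasDerivAt_solFun A v ⟨ht.1, ht.2.trans hx.2⟩

/-- Null sets do not affect the integral equation, so a weak solution satisfies it and uniqueness
applies. This makes the Sobolev solutions classical. -/
theorem HasWeakDeriv.eq_solFun {A : C(ℝ, E →L[ℝ] E)} {u g : ℝ → E} (h : HasWeakDeriv 1 u g)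
    (hg : ∀ᵐ x ∂(volume.restrict (Set.Icc (0 : ℝ) 1)), g x = A x (u x)) {x : ℝ}
    (hx : x ∈ Set.Icc (0 : ℝ) 1) : u x = solFun A (u 0) x := by
  let f : C(Set.Icc (0 : ℝ) 1, E) := ⟨(Set.Icc (0 : ℝ) 1).domRestrict u, h.continuousOn.domRestrict⟩
  have hf : solOp A (u 0) = f := by
    rw [solOp_eq_iff]
    intro y
    change u y = _
    rw [h.2 y y.2]
    congr 1
    refine intervalIntegral.integral_congr_ae ?_
    rw [ae_restrict_iff' measurableSet_Icc] at hg
    filter_upwards [hg] with t ht ht'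
    rw [Set.uIoc_of_le y.2.1] at ht'
    have ht1 : t ∈ Set.Icc (0 : ℝ) 1 := ⟨ht'.1.le, ht'.2.trans y.2.2⟩
    rw [ht ht1, extendUnit_of_mem f ht1]
    rfl
  rw [solFun_eq A _ hx, hf]
  rfl

end Volterra

/-! ### The boundary conditions define Lagrangian subspaces -/

/-- The projection `(p, q) ↦ p`. -/
def fstL (n : ℕ) : PhaseSpace n →L[ℝ] Vec n := LinearMap.toContinuousLinearMap
  { toFun := fun x => WithLp.toLp 2 fun i => x (Sum.inl i)
    map_add' := fun _ _ => rfl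
    map_smul' := fun _ _ => rfl }

/-- The projection `(p, q) ↦ q`. -/
def sndL (n : ℕ) : PhaseSpace n →L[ℝ] Vec n := LinearMap.toContinuousLinearMap
  { toFun := fun x => WithLp.toLp 2 fun i => x (Sum.inr i)
    map_add' := fun _ _ => rfl
    map_smul' := fun _ _ => rfl }

/-- The inclusion `p ↦ (p, 0)`. -/
def inlL (n : ℕ) : Vec n →L[ℝ] PhaseSpace n := LinearMap.toContinuousLinearMap
  { toFun := fun p => WithLp.toLp 2 (Sum.elim (fun i => p i) 0)
    map_add' := fun _ _ => by ext (i | i) <;> simp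
    map_smul' := fun _ _ => by ext (i | i) <;> simp }

/-- The inclusion `q ↦ (0, q)`. -/
def inrL (n : ℕ) : Vec n →L[ℝ] PhaseSpace n := LinearMap.toContinuousLinearMap
  { toFun := fun q => WithLp.toLp 2 (Sum.elim 0 (fun i => q i))
    map_add' := fun _ _ => by ext (i | i) <;> simp
    map_smul' := fun _ _ => by ext (i | i) <;> simp }

@[simp] theorem fstL_inlL (p : Vec n) : fstL n (inlL n p) = p := rfl
@[simp] theorem sndL_inlL (p : Vec n) : sndL n (inlL n p) = 0 := rfl
@[simp] theorem fstL_inrL (p : Vec n) : fstL n (inrL n p) = 0 := rfl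
@[simp] theorem sndL_inrL (p : Vec n) : sndL n (inrL n p) = p := rfl

theorem fstL_apply (x : PhaseSpace n) (i : Fin n) : fstL n x i = x (Sum.inl i) := rfl
theorem sndL_apply (x : PhaseSpace n) (i : Fin n) : sndL n x i = x (Sum.inr i) := rfl

theorem phase_ext {x y : PhaseSpace n} (h1 : fstL n x = fstL n y) (h2 : sndL n x = sndL n y) :
    x = y := by
  ext (i | i)
  · exact congrArg (fun v : Vec n => v i) h1
  · exact congrArg (fun v : Vec n => v i) h2

theorem omega_eq_sub (x y : PhaseSpace n) :
    omega x y = inner ℝ (fstL n x) (sndL n y) - inner ℝ (sndL n x) (fstL n y) := by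
  rw [omega_eq_sum]
  simp [PiLp.inner_apply, fstL_apply, sndL_apply, mul_comm]

theorem mem_targetSpace {β₁ β₂ : Matrix (Fin n) (Fin n) ℝ} {v : PhaseSpace n} :
    v ∈ targetSpace β₁ β₂ ↔ BoundaryCond β₁ β₂ (fstL n v) (sndL n v) := Iff.rfl

/-- The relation places the range of `z ↦ (β₂ᵗ z, -β₁ᵗ z)` inside the kernel of `[β₁ β₂]`. By the
rank condition both have dimension `n`, so they agree; on the range, `omega` vanishes by the same
relation. -/
theorem isLagrangian_targetSpace {β₁ β₂ : Matrix (Fin n) (Fin n) ℝ}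
    (hrank : (Matrix.fromCols β₁ β₂).rank = n)
    (h : β₁ * β₂.transpose - β₂ * β₁.transpose = 0) : IsLagrangian (targetSpace β₁ β₂) := by
  let f : PhaseSpace n →ₗ[ℝ] (Fin n → ℝ) :=
    (Matrix.fromCols β₁ β₂).mulVecLin ∘ₗ (WithLp.linearEquiv 2 ℝ (Fin n ⊕ Fin n → ℝ)).toLinearMap
  have hf : ∀ v, f v = β₁.mulVec (fstL n v) + β₂.mulVec (sndL n v) := by
    intro v
    change (Matrix.fromCols β₁ β₂).mulVec v = _
    rw [Matrix.fromCols_mulVec]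
    rfl
  have hker : LinearMap.ker f = targetSpace β₁ β₂ := by
    ext v
    rw [LinearMap.mem_ker, hf, mem_targetSpace, BoundaryCond]
  have hrange : Module.finrank ℝ (LinearMap.range f) = n := by
    have : LinearMap.range f = LinearMap.range (Matrix.fromCols β₁ β₂).mulVecLin :=
      LinearMap.range_comp_of_range_eq_top _ (LinearEquiv.range _)
    rw [this]
    exact hrank
  have hdim : Module.finrank ℝ (targetSpace β₁ β₂) = n := by
    have := f.finrank_range_add_finrank_ker
    rw [hrange, hker, finrank_phaseSpace] at this
    omega
  let g : (Fin n → ℝ) →ₗ[ℝ] PhaseSpace n :=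
    (WithLp.linearEquiv 2 ℝ (Fin n ⊕ Fin n → ℝ)).symm.toLinearMap ∘ₗ
      (Matrix.fromRows β₂.transpose (-β₁.transpose)).mulVecLin
  have hg1 : ∀ z, (fstL n (g z) : Fin n → ℝ) = β₂.transpose.mulVec z := by
    intro z
    ext i
    simp [g, fstL_apply]
  have hg2 : ∀ z, (sndL n (g z) : Fin n → ℝ) = -β₁.transpose.mulVec z := by
    intro z
    ext i
    simp [g, sndL_apply, Matrix.neg_mulVec]
  have hginj : Function.Injective g := by
    rw [injective_iff_map_eq_zero]
    intro z hz
    have h1 := hg1 z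
    have h2 := hg2 z
    rw [hz, map_zero] at h1 h2
    have h3 : (Matrix.fromCols β₁ β₂).transpose.mulVecLin z = 0 := by
      rw [Matrix.mulVecLin_apply, Matrix.transpose_fromCols, Matrix.fromRows_mulVec, ← h1,
        ← neg_eq_iff_eq_neg.2 h2]
      ext (i | i) <;> simp
    have h4 : LinearMap.ker (Matrix.fromCols β₁ β₂).transpose.mulVecLin = ⊥ := by
      have := (Matrix.fromCols β₁ β₂).transpose.mulVecLin.finrank_range_add_finrank_ker
      rw [← Submodule.finrank_eq_zero (R := ℝ)]
      have h5 : Module.finrank ℝ (LinearMap.range (Matrix.fromCols β₁ β₂).transpose.mulVecLin) =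
          n := (Matrix.rank_transpose _).trans hrank
      rw [h5] at this
      simpa using this
    exact LinearMap.ker_eq_bot'.1 h4 z h3
  have hgrange : LinearMap.range g = targetSpace β₁ β₂ := by
    apply Submodule.eq_of_le_of_finrank_eq
    · rintro _ ⟨z, rfl⟩
      rw [mem_targetSpace, BoundaryCond, hg1, hg2, Matrix.mulVec_neg, Matrix.mulVec_mulVec,
        Matrix.mulVec_mulVec, ← sub_eq_add_neg, ← Matrix.sub_mulVec, h, Matrix.zero_mulVec]
    · rw [LinearMap.finrank_range_of_inj hginj, hdim]
      simp
  have hdot : ∀ x y : Vec n, inner ℝ x y = (x : Fin n → ℝ) ⬝ᵥ (y : Fin n → ℝ) := by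
    intro x y
    simp [PiLp.inner_apply, dotProduct, mul_comm]
  refine ⟨hdim, fun x hx y hy => ?_⟩
  rw [← hgrange] at hx hy
  obtain ⟨z, rfl⟩ := hx
  obtain ⟨w, rfl⟩ := hy
  have ht : ∀ (A : Matrix (Fin n) (Fin n) ℝ) (z w : Fin n → ℝ),
      A.transpose.mulVec z ⬝ᵥ w = z ⬝ᵥ A.mulVec w := fun A z w => by
    rw [Matrix.mulVec_transpose, ← Matrix.dotProduct_mulVec]
  rw [omega_eq_sub, hdot, hdot, hg1, hg2, hg1, hg2, dotProduct_neg, neg_dotProduct, ht, ht,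
    Matrix.mulVec_mulVec, Matrix.mulVec_mulVec, sub_neg_eq_add, neg_add_eq_sub, ← dotProduct_sub,
    ← Matrix.sub_mulVec, h, Matrix.zero_mulVec, dotProduct_zero]

/-! ### The Schrödinger equation as a first order system -/

/-- The potential as an operator-valued continuous function on `ℝ`, constant outside `[0, 1]`. -/
def potOp (V : ℝ → Matrix (Fin n) (Fin n) ℝ) (hV : ContinuousOn V (Set.Icc 0 1)) :
    C(ℝ, Vec n →L[ℝ] Vec n) where
  toFun x := Matrix.toEuclideanCLM (𝕜 := ℝ) (V (Set.projIcc (0 : ℝ) 1 zero_le_one x))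
  continuous_toFun := by
    have h1 : Continuous (Matrix.toEuclideanCLM (𝕜 := ℝ) (n := Fin n)) :=
      LinearMap.continuous_of_finiteDimensional
        (Matrix.toEuclideanCLM (𝕜 := ℝ) (n := Fin n)).toAlgEquiv.toLinearMap
    exact h1.comp (hV.comp_continuous (continuous_subtype_val.comp continuous_projIcc)
      fun x => (Set.projIcc (0 : ℝ) 1 zero_le_one x).2)

theorem potOp_of_mem {V : ℝ → Matrix (Fin n) (Fin n) ℝ} (hV : ContinuousOn V (Set.Icc 0 1))
    {x : ℝ} (hx : x ∈ Set.Icc (0 : ℝ) 1) :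
    potOp V hV x = Matrix.toEuclideanCLM (𝕜 := ℝ) (V x) := by
  change Matrix.toEuclideanCLM (𝕜 := ℝ) (V (Set.projIcc (0 : ℝ) 1 zero_le_one x)) = _
  rw [Set.projIcc_of_mem zero_le_one hx]

theorem inner_potOp {V : ℝ → Matrix (Fin n) (Fin n) ℝ} (hV : ContinuousOn V (Set.Icc 0 1))
    (hs : ∀ x ∈ Set.Icc (0 : ℝ) 1, (V x).IsSymm) (x : ℝ) (p q : Vec n) :
    inner ℝ (potOp V hV x p) q = inner ℝ p (potOp V hV x q) := by
  set A := V (Set.projIcc (0 : ℝ) 1 zero_le_one x) with hA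
  have h : star (Matrix.toEuclideanCLM (𝕜 := ℝ) A) = Matrix.toEuclideanCLM (𝕜 := ℝ) A := by
    rw [← map_star, Matrix.star_eq_conjTranspose, Matrix.conjTranspose_eq_transpose_of_trivial,
      (hs _ (Set.projIcc (0 : ℝ) 1 zero_le_one x).2).eq]
  change inner ℝ (Matrix.toEuclideanCLM (𝕜 := ℝ) A p) q =
    inner ℝ p (Matrix.toEuclideanCLM (𝕜 := ℝ) A q)
  rw [← ContinuousLinearMap.adjoint_inner_right, ← ContinuousLinearMap.star_eq_adjoint, h]

/-- The coefficient of the first order system for `λ = 0`. -/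
def sysBase (V : ℝ → Matrix (Fin n) (Fin n) ℝ) (hV : ContinuousOn V (Set.Icc 0 1)) :
    C(ℝ, PhaseSpace n →L[ℝ] PhaseSpace n) where
  toFun x := inlL n ∘L sndL n + inrL n ∘L potOp V hV x ∘L fstL n
  continuous_toFun := by
    have := (potOp V hV).continuous
    fun_prop

/-- The coefficient of the first order system. -/
def sysOp (V : ℝ → Matrix (Fin n) (Fin n) ℝ) (hV : ContinuousOn V (Set.Icc 0 1)) (lam : ℝ) :
    C(ℝ, PhaseSpace n →L[ℝ] PhaseSpace n) :=
  sysBase V hV + (-lam) • ContinuousMap.const ℝ (inrL n ∘L fstL n)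

theorem sysOp_apply {V : ℝ → Matrix (Fin n) (Fin n) ℝ} (hV : ContinuousOn V (Set.Icc 0 1))
    (lam x : ℝ) (v : PhaseSpace n) :
    sysOp V hV lam x v =
      inlL n (sndL n v) + inrL n (potOp V hV x (fstL n v) - lam • fstL n v) := by
  change inlL n (sndL n v) + inrL n (potOp V hV x (fstL n v)) + (-lam) • inrL n (fstL n v) = _
  rw [map_sub, map_smul]
  module

theorem toEuclideanCLM_systemMatrix {V : ℝ → Matrix (Fin n) (Fin n) ℝ}
    (hV : ContinuousOn V (Set.Icc 0 1)) (lam : ℝ) {x : ℝ} (hx : x ∈ Set.Icc (0 : ℝ) 1)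
    (v : PhaseSpace n) :
    Matrix.toEuclideanCLM (𝕜 := ℝ) (systemMatrix V lam x) v = sysOp V hV lam x v := by
  rw [sysOp_apply, potOp_of_mem hV hx]
  have h : ∀ w : PhaseSpace n, (w : Fin n ⊕ Fin n → ℝ) =
      Sum.elim (fstL n w : Fin n → ℝ) (sndL n w : Fin n → ℝ) := by
    intro w
    ext (i | i) <;> rfl
  ext (i | i)
  · rw [Matrix.ofLp_toEuclideanCLM, systemMatrix, h v, Matrix.fromBlocks_mulVec]
    simp [inlL, inrL]
  · rw [Matrix.ofLp_toEuclideanCLM, systemMatrix, h v, Matrix.fromBlocks_mulVec]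
    simp [inlL, inrL, Matrix.sub_mulVec, Matrix.ofLp_toEuclideanCLM, Matrix.smul_mulVec]

section Flow

variable {V : ℝ → Matrix (Fin n) (Fin n) ℝ} (hV : ContinuousOn V (Set.Icc 0 1))

/-- The map `(y(0), y'(0)) ↦ (y(1), y'(1))` for the solutions of `-y'' + V y = λ y`. -/
def monodromy (lam : ℝ) : PhaseSpace n →L[ℝ] PhaseSpace n :=
  ContinuousMap.evalCLM ℝ (⟨1, by simp⟩ : Set.Icc (0 : ℝ) 1) ∘L solOp (sysOp V hV lam)

theorem monodromy_apply (lam : ℝ) (v : PhaseSpace n) :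
    monodromy hV lam v = solFun (sysOp V hV lam) v 1 :=
  (solFun_eq (sysOp V hV lam) v _).symm

theorem continuous_solOp_sysOp : Continuous fun lam => solOp (sysOp V hV lam) :=
  (continuous_solOp (sysBase V hV) _).comp continuous_neg

theorem continuous_monodromy : Continuous fun lam => monodromy hV lam :=
  continuous_const.clm_comp (continuous_solOp_sysOp hV)

theorem mem_solutionSpace_iff {α₁ α₂ : Matrix (Fin n) (Fin n) ℝ} {lam : ℝ}
    {p : ℝ → PhaseSpace n} : p ∈ solutionSpace V α₁ α₂ 1 lam ↔ ∃ p' : ℝ → PhaseSpace n,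
      HasWeakDeriv 1 p p' ∧
      (∀ᵐ x ∂(volume.restrict (Set.Icc (0 : ℝ) 1)), p' x = sysOp V hV lam x (p x)) ∧
      p 0 ∈ targetSpace α₁ α₂ := by
  refine exists_congr fun p' => and_congr_right fun _ => and_congr ?_ Iff.rfl
  rw [ae_restrict_iff' measurableSet_Icc, ae_restrict_iff' measurableSet_Icc]
  refine Filter.eventually_congr (Filter.Eventually.of_forall fun x => ?_)
  refine forall_congr' fun hx => ?_
  rw [toEuclideanCLM_systemMatrix hV lam hx]

theorem traceSpace_eq (α₁ α₂ : Matrix (Fin n) (Fin n) ℝ) (lam : ℝ) :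
    traceSpace V α₁ α₂ 1 lam = (targetSpace α₁ α₂).map (monodromy hV lam).toLinearMap := by
  ext v
  constructor
  · rintro ⟨p, hp, rfl⟩
    obtain ⟨p', h1, h2, h3⟩ := (mem_solutionSpace_iff hV).1 hp
    refine ⟨p 0, h3, ?_⟩
    change monodromy hV lam (p 0) = p 1
    rw [monodromy_apply, ← h1.eq_solFun h2 (by simp)]
  · rintro ⟨w, hw, rfl⟩
    refine ⟨solFun (sysOp V hV lam) w, (mem_solutionSpace_iff hV).2
      ⟨_, hasWeakDeriv_solFun _ _, Filter.Eventually.of_forall fun _ => rfl, ?_⟩, ?_⟩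
    · rwa [solFun_zero]
    · exact (monodromy_apply hV lam w).symm

/-- Lagrange's identity: in the derivative of `omega (y x) (z x)` the symmetric potential cancels,
and only the difference of the spectral parameters remains. -/
theorem omega_monodromy (hs : ∀ x ∈ Set.Icc (0 : ℝ) 1, (V x).IsSymm) (lam mu : ℝ)
    (v w : PhaseSpace n) :
    omega (monodromy hV lam v) (monodromy hV mu w) = omega v w +
      (lam - mu) * ∫ x in (0 : ℝ)..1, inner ℝ (fstL n (solFun (sysOp V hV lam) v x))
        (fstL n (solFun (sysOp V hV mu) w x)) := by
  set y := solFun (sysOp V hV lam) v with hy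
  set z := solFun (sysOp V hV mu) w with hz
  have hyc : Continuous y := continuous_solFun _ _
  have hzc : Continuous z := continuous_solFun _ _
  have hd : ∀ x ∈ Set.uIcc (0 : ℝ) 1, HasDerivAt (fun x => omega (y x) (z x))
      ((lam - mu) * inner ℝ (fstL n (y x)) (fstL n (z x))) x := by
    intro x hx
    rw [Set.uIcc_of_le zero_le_one] at hx
    have h1 := ((Jmap n).hasFDerivAt.comp_hasDerivAt x
      (hasDerivAt_solFun (sysOp V hV lam) v hx)).inner ℝ (hasDerivAt_solFun (sysOp V hV mu) w hx)
    refine h1.congr_deriv ?_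
    change omega (y x) (sysOp V hV mu x (z x)) + omega (sysOp V hV lam x (y x)) (z x) = _
    rw [omega_eq_sub, omega_eq_sub, sysOp_apply, sysOp_apply]
    simp only [map_add, fstL_inlL, fstL_inrL, sndL_inlL, sndL_inrL, add_zero, zero_add,
      inner_sub_left, inner_sub_right, inner_smul_left, inner_smul_right, inner_potOp hV hs,
      conj_trivial]
    ring
  have h := intervalIntegral.integral_eq_sub_of_hasDerivAt hd
    (Continuous.intervalIntegrable (by fun_prop) _ _)
  rw [intervalIntegral.integral_const_mul] at h
  rw [h, hy, hz, solFun_zero, solFun_zero, monodromy_apply, monodromy_apply]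
  ring

/-- For equal parameters the map preserves `omega`, and `omega v (J v)` is the square of the norm of
`v`. -/
theorem monodromy_injective (hs : ∀ x ∈ Set.Icc (0 : ℝ) 1, (V x).IsSymm) (lam : ℝ) :
    Function.Injective (monodromy hV lam) := by
  rw [injective_iff_map_eq_zero]
  intro v hv
  have h := omega_monodromy hV hs lam lam v (Jmap n v)
  rw [hv, sub_self, zero_mul, add_zero, omega_eq_inner, map_zero, inner_zero_left,
    omega_eq_inner, inner_Jmap_Jmap] at h
  exact inner_self_eq_zero.1 h.symm

theorem isLagrangian_map_monodromy (hs : ∀ x ∈ Set.Icc (0 : ℝ) 1, (V x).IsSymm) (lam : ℝ)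
    {l : Submodule ℝ (PhaseSpace n)} (hl : IsLagrangian l) :
    IsLagrangian (l.map (monodromy hV lam).toLinearMap) := by
  refine ⟨?_, ?_⟩
  · rw [finrank_map_of_injective (monodromy_injective hV hs lam), hl.1]
  · rintro _ ⟨v, hv, rfl⟩ _ ⟨w, hw, rfl⟩
    refine (omega_monodromy hV hs lam lam v w).trans ?_
    rw [hl.2 v hv w hw]
    simp

/-- If `y` vanishes on the interval, so does `y'(0)`, hence all initial data. Both the definiteness
of the L² form on solutions and the injectivity of `solL2` rest on this. -/
theorem eq_zero_of_fst_eq_zero (lam : ℝ) {v : PhaseSpace n}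
    (h : ∀ x ∈ Set.Icc (0 : ℝ) 1, fstL n (solFun (sysOp V hV lam) v x) = 0) : v = 0 := by
  have h0 : (0 : ℝ) ∈ Set.Icc (0 : ℝ) 1 := by simp
  have h1 : fstL n v = 0 := by simpa [solFun_zero] using h 0 h0
  have hd : HasDerivWithinAt (fun x => fstL n (solFun (sysOp V hV lam) v x)) (sndL n v)
      (Set.Icc 0 1) 0 := by
    have := ((fstL n).hasFDerivAt.comp_hasDerivAt (0 : ℝ)
      (hasDerivAt_solFun (sysOp V hV lam) v h0)).hasDerivWithinAt (s := Set.Icc 0 1)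
    refine this.congr_deriv ?_
    rw [sysOp_apply, solFun_zero]
    simp
  have hd' : HasDerivWithinAt (fun x => fstL n (solFun (sysOp V hV lam) v x)) 0
      (Set.Icc 0 1) 0 :=
    (hasDerivWithinAt_const (0 : ℝ) (Set.Icc (0 : ℝ) 1) (0 : Vec n)).congr h (h 0 h0)
  have h2 := (uniqueDiffOn_Icc_zero_one 0 h0).eq_deriv _ hd hd'
  exact phase_ext (by simpa using h1) (by simpa using h2)

end Flow

section Eigenvalues

variable {V : ℝ → Matrix (Fin n) (Fin n) ℝ} (hV : ContinuousOn V (Set.Icc 0 1))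

theorem integral_fst_sq_pos (lam : ℝ) {v : PhaseSpace n} (hv : v ≠ 0) :
    0 < ∫ x in (0 : ℝ)..1, inner ℝ (fstL n (solFun (sysOp V hV lam) v x))
      (fstL n (solFun (sysOp V hV lam) v x)) := by
  have hc : Continuous (solFun (sysOp V hV lam) v) := continuous_solFun _ _
  refine intervalIntegral.integral_pos one_pos (by fun_prop)
    (fun x _ => real_inner_self_nonneg) ?_
  by_contra! h
  refine hv (eq_zero_of_fst_eq_zero hV lam fun x hx => ?_)
  exact inner_self_eq_zero.1 (le_antisymm (h x hx) real_inner_self_nonneg)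

/-! ### Absence of very negative eigenvalues -/

/-- On a Lagrangian subspace `⟪p, q⟫` depends on `p` alone: two vectors with the same `p` differ by
some `(0, r)` in `l`, and `omega` of `(p, q)` with it is `⟪p, r⟫ = 0`. A linear section of `v ↦ p`
then gives a quadratic bound. -/
theorem IsLagrangian.exists_bound {l : Submodule ℝ (PhaseSpace n)} (hl : IsLagrangian l) :
    ∃ C : ℝ, 0 ≤ C ∧ ∀ v ∈ l, |inner ℝ (fstL n v) (sndL n v)| ≤ C * ‖fstL n v‖ ^ 2 := by
  let f : l →ₗ[ℝ] Vec n := (fstL n).toLinearMap ∘ₗ l.subtype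
  obtain ⟨g, hg⟩ := f.rangeRestrict.exists_rightInverse_of_surjective f.range_rangeRestrict
  let h : LinearMap.range f →L[ℝ] Vec n :=
    LinearMap.toContinuousLinearMap ((sndL n).toLinearMap ∘ₗ l.subtype ∘ₗ g)
  refine ⟨‖h‖, h.opNorm_nonneg, fun v hv => ?_⟩
  let p : LinearMap.range f := f.rangeRestrict ⟨v, hv⟩
  have hp : (p : Vec n) = fstL n v := rfl
  have h1 : fstL n (g p) = fstL n v := congrArg Subtype.val (LinearMap.congr_fun hg p)
  have h2 := hl.2 v hv (v - g p) (l.sub_mem hv (g p).2)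
  rw [omega_eq_sub, map_sub, map_sub, h1, sub_self, inner_zero_right, sub_zero, inner_sub_right,
    sub_eq_zero] at h2
  rw [h2]
  calc |inner ℝ (fstL n v) (sndL n (g p))| ≤ ‖fstL n v‖ * ‖h p‖ := abs_real_inner_le_norm _ _
    _ ≤ ‖fstL n v‖ * (‖h‖ * ‖p‖) :=
        mul_le_mul_of_nonneg_left (h.le_opNorm p) (norm_nonneg _)
    _ = ‖h‖ * ‖fstL n v‖ ^ 2 := by rw [← hp, Submodule.coe_norm]; ring

theorem exists_forall_inf_eq_bot {l l₁ : Submodule ℝ (PhaseSpace n)} (hl : IsLagrangian l)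
    (hl₁ : IsLagrangian l₁) :
    ∃ L : ℝ, 0 < L ∧ ∀ lam < -L, l.map (monodromy hV lam).toLinearMap ⊓ l₁ = ⊥ := by
  obtain ⟨C₀, hC₀, h0⟩ := hl.exists_bound
  obtain ⟨C₁, hC₁, h1⟩ := hl₁.exists_bound
  obtain ⟨M, hM0, hM⟩ := exists_norm_le_of_continuousMap (potOp V hV)
  set C := C₀ + C₁ with hC
  -- `M` bounds the potential, `2 * C` is the derivative of the weight below, `C ^ 2` completes the
  -- square against `‖q‖ ^ 2`, and 1 leaves `‖p‖ ^ 2` as a surplus.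
  refine ⟨M + 2 * C + C ^ 2 + 1, by positivity, fun lam hlam => ?_⟩
  rw [eq_bot_iff]
  rintro _ ⟨⟨v, hv, rfl⟩, hw⟩
  have hw : monodromy hV lam v ∈ l₁ := hw
  by_contra hne
  have hv0 : v ≠ 0 := by
    rintro rfl
    exact hne (map_zero (monodromy hV lam))
  have hpos := integral_fst_sq_pos hV lam hv0
  set Y := solFun (sysOp V hV lam) v with hY
  have hYc : Continuous Y := continuous_solFun _ _
  have hPc : Continuous (potOp V hV) := (potOp V hV).continuous
  -- The weight `C * (2 * x - 1)` runs from `-C` to `C`, so the boundary bounds give `φ 0 ≥ 0` and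
  -- `φ 1 ≤ 0`. But `φ'` is at least `‖p‖ ^ 2`, whose integral is positive: a contradiction.
  set φ : ℝ → ℝ := fun x => inner ℝ (fstL n (Y x)) (sndL n (Y x)) -
    (C * (2 * x - 1)) * inner ℝ (fstL n (Y x)) (fstL n (Y x)) with hφ
  set φ' : ℝ → ℝ := fun x => (inner ℝ (fstL n (Y x)) (potOp V hV x (fstL n (Y x)) -
      lam • fstL n (Y x)) + inner ℝ (sndL n (Y x)) (sndL n (Y x))) -
    ((C * 2) * inner ℝ (fstL n (Y x)) (fstL n (Y x)) +
      (C * (2 * x - 1)) * (inner ℝ (fstL n (Y x)) (sndL n (Y x)) +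
        inner ℝ (sndL n (Y x)) (fstL n (Y x)))) with hφ'
  have hφc : Continuous φ' := by fun_prop
  have hd : ∀ x ∈ Set.uIcc (0 : ℝ) 1, HasDerivAt φ (φ' x) x := by
    intro x hx
    rw [Set.uIcc_of_le zero_le_one] at hx
    have hd := hasDerivAt_solFun (sysOp V hV lam) v hx
    rw [sysOp_apply] at hd
    have h1 : HasDerivAt (fun x => fstL n (Y x)) (sndL n (Y x)) x :=
      ((fstL n).hasFDerivAt.comp_hasDerivAt x hd).congr_deriv (by simp [hY])
    have h2 : HasDerivAt (fun x => sndL n (Y x))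
        (potOp V hV x (fstL n (Y x)) - lam • fstL n (Y x)) x :=
      ((sndL n).hasFDerivAt.comp_hasDerivAt x hd).congr_deriv (by simp [hY])
    have h3 : HasDerivAt (fun x : ℝ => C * (2 * x - 1)) (C * 2) x := by
      simpa using (((hasDerivAt_id x).const_mul 2).sub_const 1).const_mul C
    exact (h1.inner ℝ h2).sub (h3.mul (h1.inner ℝ h1))
  have hint := intervalIntegral.integral_eq_sub_of_hasDerivAt hd (hφc.intervalIntegrable _ _)
  have hle : ∫ x in (0 : ℝ)..1, inner ℝ (fstL n (Y x)) (fstL n (Y x)) ≤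
      ∫ x in (0 : ℝ)..1, φ' x := by
    refine intervalIntegral.integral_mono_on zero_le_one
      (Continuous.intervalIntegrable (by fun_prop) _ _) (hφc.intervalIntegrable _ _) fun x hx => ?_
    simp only [hφ', inner_sub_right, inner_smul_right, real_inner_self_eq_norm_sq,
      real_inner_comm (fstL n (Y x)) (sndL n (Y x))]
    set p := fstL n (Y x)
    set q := sndL n (Y x)
    have e1 : -(M * ‖p‖ ^ 2) ≤ inner ℝ p (potOp V hV x p) := by
      have := abs_real_inner_le_norm p (potOp V hV x p)
      have h2 : ‖p‖ * ‖potOp V hV x p‖ ≤ ‖p‖ * (M * ‖p‖) :=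
        mul_le_mul_of_nonneg_left (((potOp V hV x).le_opNorm p).trans
          (mul_le_mul_of_nonneg_right (hM x hx) (norm_nonneg _))) (norm_nonneg _)
      have h3 := (abs_le.1 this).1
      nlinarith
    have e2 : (2 * x - 1) * inner ℝ p q ≤ ‖p‖ * ‖q‖ := by
      refine (le_abs_self _).trans ?_
      rw [abs_mul]
      have h2 : |2 * x - 1| ≤ 1 := abs_le.2 ⟨by linarith [hx.1], by linarith [hx.2]⟩
      exact (mul_le_of_le_one_left (abs_nonneg _) h2).trans (abs_real_inner_le_norm _ _)
    have hC0 : 0 ≤ C := by positivity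
    have e3 := mul_le_mul_of_nonneg_left e2 hC0
    have e4 : (M + 2 * C + C ^ 2 + 1) * ‖p‖ ^ 2 ≤ -lam * ‖p‖ ^ 2 :=
      mul_le_mul_of_nonneg_right (by linarith) (sq_nonneg _)
    nlinarith [sq_nonneg (‖q‖ - C * ‖p‖)]
  have hφ1 : φ 1 ≤ 0 := by
    have := (abs_le.1 (h1 _ hw)).2
    rw [monodromy_apply] at this
    simp only [hφ, real_inner_self_eq_norm_sq]
    have h2 : 0 ≤ C₀ * ‖fstL n (Y 1)‖ ^ 2 := by positivity
    rw [hC]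
    linarith
  have hφ0 : 0 ≤ φ 0 := by
    have := (abs_le.1 (h0 v hv)).1
    simp only [hφ, hY, solFun_zero, real_inner_self_eq_norm_sq]
    have h2 : 0 ≤ C₁ * ‖fstL n v‖ ^ 2 := by positivity
    rw [hC]
    linarith
  linarith

/-! ### Eigenspaces of the Schrödinger operator -/

theorem HasWeakDeriv.clm_comp {E F : Type*} [NormedAddCommGroup E] [NormedSpace ℝ E]
    [CompleteSpace E] [NormedAddCommGroup F] [NormedSpace ℝ F] [CompleteSpace F]
    {u g : ℝ → E} (h : HasWeakDeriv 1 u g) (T : E →L[ℝ] F) :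
    HasWeakDeriv 1 (fun x => T (u x)) (fun x => T (g x)) := by
  refine ⟨T.comp_memLp' h.1, fun x hx => ?_⟩
  beta_reduce
  rw [h.2 x hx, map_add, ← T.intervalIntegral_comp_comm (h.intervalIntegrable hx)]

theorem memLp_fst_solFun (lam : ℝ) (v : PhaseSpace n) :
    MemLp (fun x => fstL n (solFun (sysOp V hV lam) v x)) 2
      (volume.restrict (Set.Icc (0 : ℝ) 1)) := by
  have hc : Continuous fun x => fstL n (solFun (sysOp V hV lam) v x) :=
    (fstL n).continuous.comp (continuous_solFun _ _)
  obtain ⟨M, -, hM⟩ := exists_norm_le_of_continuousMap ⟨_, hc⟩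
  exact MemLp.of_bound hc.aestronglyMeasurable M
    ((ae_restrict_iff' measurableSet_Icc).2 (Filter.Eventually.of_forall hM))

/-- The solution `y` of `-y'' + V y = λ y` with given `(y(0), y'(0))` as an element of `L²`. -/
def solL2 (lam : ℝ) : PhaseSpace n →ₗ[ℝ] L2 n where
  toFun v := (memLp_fst_solFun hV lam v).toLp
  map_add' v w := by
    rw [← MemLp.toLp_add]
    refine MemLp.toLp_congr _ _ ?_
    refine (ae_restrict_iff' measurableSet_Icc).2 (Filter.Eventually.of_forall fun x hx => ?_)
    beta_reduce
    rw [Pi.add_apply, solFun_eq _ _ hx, solFun_eq _ _ hx, solFun_eq _ _ hx, map_add,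
      ContinuousMap.add_apply, map_add]
  map_smul' c v := by
    rw [RingHom.id_apply, ← MemLp.toLp_const_smul]
    refine MemLp.toLp_congr _ _ ?_
    refine (ae_restrict_iff' measurableSet_Icc).2 (Filter.Eventually.of_forall fun x hx => ?_)
    beta_reduce
    rw [Pi.smul_apply, solFun_eq _ _ hx, solFun_eq _ _ hx, map_smul,
      ContinuousMap.smul_apply, map_smul]

theorem solL2_ae_eq (lam : ℝ) (v : PhaseSpace n) :
    ∀ᵐ x ∂(volume.restrict (Set.Icc (0 : ℝ) 1)),
      solL2 hV lam v x = fstL n (solFun (sysOp V hV lam) v x) :=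
  (memLp_fst_solFun hV lam v).coeFn_toLp

theorem solL2_injective (lam : ℝ) : Function.Injective (solL2 hV lam) := by
  rw [injective_iff_map_eq_zero]
  intro v hv
  have h1 := solL2_ae_eq hV lam v
  have h2 : (fun x => fstL n (solFun (sysOp V hV lam) v x))
      =ᵐ[volume.restrict (Set.Icc (0 : ℝ) 1)] fun _ => 0 := by
    filter_upwards [h1, Lp.coeFn_zero (Vec n) 2 (volume.restrict (Set.Icc (0 : ℝ) 1))] with x a b
    rw [← a, hv, b, Pi.zero_apply]
  have hc : Continuous fun x => fstL n (solFun (sysOp V hV lam) v x) :=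
    (fstL n).continuous.comp (continuous_solFun _ _)
  exact eq_zero_of_fst_eq_zero hV lam fun x hx =>
    Measure.eqOn_Icc_of_ae_eq volume zero_ne_one h2 hc.continuousOn continuousOn_const hx

/-- An eigenfunction is the solution with its own initial data, and the two boundary conditions
become conditions on those data and on their image under the monodromy. -/
theorem eigenspaceH_eq (α₁ α₂ β₁ β₂ : Matrix (Fin n) (Fin n) ℝ) (mu : ℝ) :
    eigenspaceH V α₁ α₂ β₁ β₂ mu =
      (targetSpace α₁ α₂ ⊓ (targetSpace β₁ β₂).comap (monodromy hV mu).toLinearMap).map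
        (solL2 hV mu) := by
  have hVx : ∀ᵐ x ∂(volume.restrict (Set.Icc (0 : ℝ) 1)),
      Matrix.toEuclideanCLM (𝕜 := ℝ) (V x) = potOp V hV x :=
    (ae_restrict_iff' measurableSet_Icc).2
      (Filter.Eventually.of_forall fun x hx => (potOp_of_mem hV hx).symm)
  ext f
  constructor
  · rintro ⟨y, y', y'', h1, h2, h3, h4, h5, h6⟩
    have h5 : ∀ᵐ x ∂(volume.restrict (Set.Icc (0 : ℝ) 1)), f x = y x := h5
    have h6 : ∀ᵐ x ∂(volume.restrict (Set.Icc (0 : ℝ) 1)), (mu • f) x =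
      -y'' x + Matrix.toEuclideanCLM (𝕜 := ℝ) (V x) (y x) := h6
    have hw := (h1.clm_comp (inlL n)).add (h2.clm_comp (inrL n))
    set P := (fun x => inlL n (y x)) + fun x => inrL n (y' x) with hP
    have hP1 : ∀ x, fstL n (P x) = y x := fun x => by simp [hP]
    have hP2 : ∀ x, sndL n (P x) = y' x := fun x => by simp [hP]
    have hode : ∀ᵐ x ∂(volume.restrict (Set.Icc (0 : ℝ) 1)),
        ((fun x => inlL n (y' x)) + fun x => inrL n (y'' x)) x = sysOp V hV mu x (P x) := by
      filter_upwards [h5, h6, Lp.coeFn_smul mu f, hVx] with x a b c d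
      rw [sysOp_apply, hP1, hP2, Pi.add_apply]
      rw [c, Pi.smul_apply, a, d] at b
      congr 2
      rw [b]
      abel
    have hsol := fun x hx => hw.eq_solFun hode (x := x) hx
    refine ⟨P 0, ⟨?_, ?_⟩, ?_⟩
    · rw [SetLike.mem_coe, mem_targetSpace, hP1, hP2]
      exact h3
    · rw [SetLike.mem_coe, Submodule.mem_comap]
      change monodromy hV mu (P 0) ∈ _
      rw [monodromy_apply, ← hsol 1 (by simp), mem_targetSpace, hP1, hP2]
      exact h4
    · apply Lp.ext
      filter_upwards [h5, solL2_ae_eq hV mu (P 0),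
        (ae_restrict_iff' measurableSet_Icc).2 (Filter.Eventually.of_forall hsol)] with x a b c
      rw [b, ← c, hP1, a]
  · rintro ⟨v, ⟨hv1, hv2⟩, rfl⟩
    have hv2 : monodromy hV mu v ∈ targetSpace β₁ β₂ := hv2
    have hw := hasWeakDeriv_solFun (sysOp V hV mu) v
    set Y := solFun (sysOp V hV mu) v with hY
    refine ⟨fun x => fstL n (Y x), fun x => sndL n (Y x),
      fun x => potOp V hV x (fstL n (Y x)) - mu • fstL n (Y x), ?_, ?_, ?_, ?_, ?_, ?_⟩
    · simpa [sysOp_apply] using hw.clm_comp (fstL n)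
    · simpa [sysOp_apply] using hw.clm_comp (sndL n)
    · beta_reduce
      rw [hY, solFun_zero]
      exact hv1
    · rw [monodromy_apply] at hv2
      exact hv2
    · exact solL2_ae_eq hV mu v
    · have : ∀ᵐ x ∂(volume.restrict (Set.Icc (0 : ℝ) 1)), (mu • solL2 hV mu v) x =
          -(potOp V hV x (fstL n (Y x)) - mu • fstL n (Y x)) +
            Matrix.toEuclideanCLM (𝕜 := ℝ) (V x) (fstL n (Y x)) := by
        filter_upwards [solL2_ae_eq hV mu v, Lp.coeFn_smul mu (solL2 hV mu v), hVx] with x a b c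
        rw [b, Pi.smul_apply, a, c]
        abel
      exact this

/-- Eigenspace and crossing are images of one space of initial data under the injective maps `solL2`
and `monodromy`. -/
theorem toENat_rank_eigenspaceH (hV : ContinuousOn V (Set.Icc 0 1))
    (hs : ∀ x ∈ Set.Icc (0 : ℝ) 1, (V x).IsSymm)
    (α₁ α₂ β₁ β₂ : Matrix (Fin n) (Fin n) ℝ) (mu : ℝ) :
    Cardinal.toENat (Module.rank ℝ (eigenspaceH V α₁ α₂ β₁ β₂ mu)) =
      (Module.finrank ℝ (traceSpace V α₁ α₂ 1 mu ⊓ targetSpace β₁ β₂ :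
        Submodule ℝ (PhaseSpace n)) : ℕ∞) := by
  have hfin : FiniteDimensional ℝ (eigenspaceH V α₁ α₂ β₁ β₂ mu) := by
    rw [eigenspaceH_eq hV]
    infer_instance
  rw [← Module.finrank_eq_rank, Cardinal.toENat_nat, eigenspaceH_eq hV,
    finrank_map_of_injective (solL2_injective hV mu), traceSpace_eq hV,
    Submodule.map_inf_eq_map_inf_comap, finrank_map_of_injective (monodromy_injective hV hs mu)]

end Eigenvalues

/-! ### Monotone paths of Lagrangian subspaces -/

/-- The constant is the minimum on the compact unit sphere, which is empty when `n = 0`. -/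
theorem exists_pos_forall_mul_sq_le {G : Type*} [NormedAddCommGroup G] [NormedSpace ℝ G]
    (B : G →L[ℝ] G →L[ℝ] ℝ) (T : Vec n →L[ℝ] G) (h : ∀ a, a ≠ 0 → 0 < B (T a) (T a)) :
    ∃ c : ℝ, 0 < c ∧ ∀ a, c * ‖a‖ ^ 2 ≤ B (T a) (T a) := by
  rcases (Metric.sphere (0 : Vec n) 1).eq_empty_or_nonempty with h0 | h0
  · refine ⟨1, one_pos, fun a => ?_⟩
    have : a = 0 := by
      by_contra ha
      have : (‖a‖⁻¹ • a) ∈ Metric.sphere (0 : Vec n) 1 := by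
        rw [mem_sphere_zero_iff_norm, norm_smul, norm_inv, norm_norm,
          inv_mul_cancel₀ (norm_ne_zero_iff.2 ha)]
      rw [h0] at this
      exact this
    simp [this]
  · obtain ⟨a₀, ha₀, hmin⟩ := (isCompact_sphere (0 : Vec n) 1).exists_isMinOn h0
      (f := fun a => B (T a) (T a)) (by fun_prop)
    refine ⟨B (T a₀) (T a₀), h a₀ (by rintro rfl; simp at ha₀), fun a => ?_⟩
    rcases eq_or_ne a 0 with rfl | ha
    · simp
    have hmem : (‖a‖⁻¹ • a) ∈ Metric.sphere (0 : Vec n) 1 := by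
      rw [mem_sphere_zero_iff_norm, norm_smul, norm_inv, norm_norm,
        inv_mul_cancel₀ (norm_ne_zero_iff.2 ha)]
    have h1 : B (T a₀) (T a₀) ≤ B (T (‖a‖⁻¹ • a)) (T (‖a‖⁻¹ • a)) := hmin hmem
    simp only [map_smul, smul_apply, smul_eq_mul] at h1
    have h2 : 0 < ‖a‖ := norm_pos_iff.2 ha
    calc B (T a₀) (T a₀) * ‖a‖ ^ 2
        ≤ (‖a‖⁻¹ * (‖a‖⁻¹ * B (T a) (T a))) * ‖a‖ ^ 2 :=
          mul_le_mul_of_nonneg_right h1 (sq_nonneg _)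
      _ = B (T a) (T a) := by field_simp

/-- A continuous path of Lagrangian subspaces `range (F t)`, with the form `B`, evaluated along the
path `y` of operators, that measures its (positive) speed. -/
structure MonotoneFrame (n : ℕ) (G : Type*) [NormedAddCommGroup G] [NormedSpace ℝ G] where
  F : ℝ → Vec n →L[ℝ] PhaseSpace n
  y : ℝ → Vec n →L[ℝ] G
  B : G →L[ℝ] G →L[ℝ] ℝ
  F_cont : Continuous F
  y_cont : Continuous y
  F_inj : ∀ t, Function.Injective (F t)
  lagrangian : ∀ t, IsLagrangian (LinearMap.range (F t).toLinearMap)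
  -- An exact identity for any two parameters, which replaces a derivative of the path.
  omega_eq : ∀ t s z w, omega (F t z) (F s w) = (s - t) * B (y t z) (y s w)
  pos : ∀ t z, z ≠ 0 → 0 < B (y t z) (y t z)

namespace MonotoneFrame

variable {G : Type*} [NormedAddCommGroup G] [NormedSpace ℝ G] (Y : MonotoneFrame n G)
  {u : Vec n →ₗᵢ[ℝ] PhaseSpace n}

/-- The subspace at the parameter `t`. -/
def space (t : ℝ) : Submodule ℝ (PhaseSpace n) := LinearMap.range (Y.F t).toLinearMap

theorem isLagrangian_space (t : ℝ) : IsLagrangian (Y.space t) := Y.lagrangian t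

/-- For injective `F` the orthogonal projection onto its range is `F (F* F)⁻¹ F*`. -/
theorem continuous_projMatrix : Continuous fun t => projMatrix (Y.space t) := by
  let R : ℝ → Vec n →L[ℝ] Vec n := fun t => ContinuousLinearMap.adjoint (Y.F t) ∘L Y.F t
  have hadj : Continuous fun t => ContinuousLinearMap.adjoint (Y.F t) :=
    (ContinuousLinearMap.adjoint (𝕜 := ℝ) (E := Vec n) (F := PhaseSpace n)).continuous.comp Y.F_cont
  have hR : Continuous R := hadj.clm_comp Y.F_cont
  have hunit : ∀ t, IsUnit (R t) := by
    intro t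
    apply isUnit_of_injective
    rw [injective_iff_map_eq_zero]
    intro a ha
    have h : inner ℝ (Y.F t a) (Y.F t a) = 0 := by
      rw [← ContinuousLinearMap.adjoint_inner_right]
      change inner ℝ a (R t a) = 0
      rw [ha, inner_zero_right]
    exact Y.F_inj t (by rw [inner_self_eq_zero.1 h, map_zero])
  have hinv : Continuous fun t => Ring.inverse (R t) := by
    refine continuous_iff_continuousAt.2 fun t => ?_
    obtain ⟨U, hU⟩ := hunit t
    refine ContinuousAt.comp (g := Ring.inverse) (f := R) ?_ hR.continuousAt
    rw [← hU]
    exact NormedRing.inverse_continuousAt (R := Vec n →L[ℝ] Vec n) U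
  have hproj : ∀ t, (Y.space t).starProjection =
      Y.F t ∘L Ring.inverse (R t) ∘L ContinuousLinearMap.adjoint (Y.F t) := by
    intro t
    ext1 x
    apply Submodule.eq_starProjection_of_mem_orthogonal
    · exact ⟨_, rfl⟩
    · rw [Submodule.mem_orthogonal]
      rintro _ ⟨a, rfl⟩
      change inner ℝ (Y.F t a) _ = 0
      rw [← ContinuousLinearMap.adjoint_inner_right, map_sub]
      have h := congrArg (fun T : Vec n →L[ℝ] Vec n => T (ContinuousLinearMap.adjoint (Y.F t) x))
        (Ring.mul_inverse_cancel _ (hunit t))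
      have h' : ContinuousLinearMap.adjoint (Y.F t) ((Y.F t ∘L Ring.inverse (R t) ∘L
          ContinuousLinearMap.adjoint (Y.F t)) x) = ContinuousLinearMap.adjoint (Y.F t) x := h
      rw [h', sub_self, inner_zero_right]
  have h2 : Continuous (Matrix.toEuclideanCLM (𝕜 := ℝ) (n := Fin n ⊕ Fin n)).symm :=
    LinearMap.continuous_of_finiteDimensional
      (Matrix.toEuclideanCLM (𝕜 := ℝ) (n := Fin n ⊕ Fin n)).symm.toAlgEquiv.toLinearMap
  refine h2.comp ?_
  simp only [hproj]
  exact Y.F_cont.clm_comp (hinv.clm_comp hadj)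

theorem circleEigenspace_eq_bot_iff (hu : IsLagrangian (LinearMap.range u.toLinearMap))
    {θ : ℝ} (hθ : Real.sin (θ / 2) ≠ 0) (t : ℝ) :
    circleEigenspace (wTilde (Y.space t) (LinearMap.range u.toLinearMap)) θ = ⊥ ↔
      IsUnit (graphFst u (θ / 2) ∘L Y.F t) := by
  rw [← Submodule.finrank_eq_zero (R := ℂ), finrank_circleEigenspace (Y.isLagrangian_space t) hu,
    Submodule.finrank_eq_zero]
  constructor
  · exact isUnit_graphFst_comp hu hθ (Y.F_inj t)
  · intro h
    rw [eq_bot_iff]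
    rintro _ ⟨⟨a, rfl⟩, ⟨_, ⟨g, rfl⟩, hg⟩⟩
    have hg : rot (θ / 2) (u g) = Y.F t a := hg
    have h1 : graphFst u (θ / 2) (Y.F t a) = 0 := by
      have := graphFst_apply hu hθ 0 g
      rwa [map_zero, zero_add, hg] at this
    have h2 : a = 0 := by
      have := congrArg (fun T : Vec n →L[ℝ] Vec n => T a) (Ring.inverse_mul_cancel _ h)
      change Ring.inverse (graphFst u (θ / 2) ∘L Y.F t) (graphFst u (θ / 2) (Y.F t a)) = a at this
      rw [h1, map_zero] at this
      exact this.symm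
    subst h2
    exact map_zero (Y.F t)

theorem isOpen_isUnit_graphFst (φ : ℝ) : IsOpen {t | IsUnit (graphFst u φ ∘L Y.F t)} :=
  (Units.isOpen (R := Vec n →L[ℝ] Vec n)).preimage (continuous_const.clm_comp Y.F_cont)

/-- The dimension of the intersection with the target. -/
def crossing (u : Vec n →ₗᵢ[ℝ] PhaseSpace n) (t : ℝ) : ℕ :=
  Module.finrank ℝ (Y.space t ⊓ LinearMap.range u.toLinearMap : Submodule ℝ (PhaseSpace n))

theorem continuousAt_inverse_graphFst {φ t : ℝ} (hX : IsUnit (graphFst u φ ∘L Y.F t)) :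
    ContinuousAt (fun s => Ring.inverse (graphFst u φ ∘L Y.F s)) t := by
  obtain ⟨U, hU⟩ := hX
  refine ContinuousAt.comp (g := Ring.inverse) (f := fun s => graphFst u φ ∘L Y.F s) ?_
    (continuous_const.clm_comp Y.F_cont).continuousAt
  rw [← hU]
  exact NormedRing.inverse_continuousAt (R := Vec n →L[ℝ] Vec n) U

/-- At `s = t` the form is bounded below by `c * ‖a‖ ^ 2`; operator-norm continuity keeps it
positive for all `a` on a common neighbourhood. -/
theorem eventually_pos {φ t : ℝ} (hX : IsUnit (graphFst u φ ∘L Y.F t)) :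
    ∀ᶠ s in nhds t, ∀ a, a ≠ 0 →
      0 < Y.B (Y.y t (Ring.inverse (graphFst u φ ∘L Y.F t) a))
        (Y.y s (Ring.inverse (graphFst u φ ∘L Y.F s) a)) := by
  set T : ℝ → Vec n →L[ℝ] G := fun s => Y.y s ∘L Ring.inverse (graphFst u φ ∘L Y.F s) with hT
  have hTc : ContinuousAt T t :=
    Y.y_cont.continuousAt.clm_comp (Y.continuousAt_inverse_graphFst hX)
  have hpos : ∀ a, a ≠ 0 → 0 < Y.B (T t a) (T t a) := by
    intro a ha
    refine Y.pos t _ fun h => ha ?_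
    have := congrArg (fun S : Vec n →L[ℝ] Vec n => S a) (Ring.mul_inverse_cancel _ hX)
    change (graphFst u φ ∘L Y.F t) (Ring.inverse (graphFst u φ ∘L Y.F t) a) = a at this
    rw [show Ring.inverse (graphFst u φ ∘L Y.F t) a = 0 from h, map_zero] at this
    exact this.symm
  obtain ⟨c, hc, hcb⟩ := exists_pos_forall_mul_sq_le Y.B (T t) hpos
  have hsmall : ContinuousAt (fun s => ‖Y.B‖ * ‖T t‖ * ‖T s - T t‖) t :=
    continuousAt_const.mul (hTc.sub continuousAt_const).norm
  have hev : ∀ᶠ s in nhds t, ‖Y.B‖ * ‖T t‖ * ‖T s - T t‖ < c :=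
    hsmall.eventually_lt continuousAt_const (by simpa using hc)
  filter_upwards [hev] with s hs a ha
  have h1 : Y.B (T t a) (T s a) = Y.B (T t a) (T t a) + Y.B (T t a) ((T s - T t) a) := by
    rw [← map_add, sub_apply, add_sub_cancel]
  have h2 : |Y.B (T t a) ((T s - T t) a)| ≤ ‖Y.B‖ * ‖T t‖ * ‖T s - T t‖ * ‖a‖ ^ 2 := by
    calc |Y.B (T t a) ((T s - T t) a)| ≤ ‖Y.B‖ * ‖T t a‖ * ‖(T s - T t) a‖ :=
          Y.B.le_opNorm₂ _ _
      _ ≤ ‖Y.B‖ * (‖T t‖ * ‖a‖) * (‖T s - T t‖ * ‖a‖) := by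
          gcongr
          · exact (T t).le_opNorm a
          · exact (T s - T t).le_opNorm a
      _ = ‖Y.B‖ * ‖T t‖ * ‖T s - T t‖ * ‖a‖ ^ 2 := by ring
  have h3 : ‖Y.B‖ * ‖T t‖ * ‖T s - T t‖ * ‖a‖ ^ 2 < c * ‖a‖ ^ 2 :=
    mul_lt_mul_of_pos_right hs (pow_pos (norm_pos_iff.2 ha) 2)
  have h4 := hcb a
  have h5 := (abs_le.1 h2).1
  change 0 < Y.B (T t a) (T s a)
  rw [h1]
  linarith

/-- Local behaviour of the number of the eigenvalues of `W̃` on an arc. -/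
theorem eventually_arcCount (hu : IsLagrangian (LinearMap.range u.toLinearMap))
    {ε : ℝ} (hε : ε ∈ Set.Ioo 0 Real.pi) {t : ℝ}
    (hX : IsUnit (graphFst u (ε / 2) ∘L Y.F t)) :
    ∀ᶠ s in nhds t,
      (t < s → arcCount (wTilde (Y.space s) (LinearMap.range u.toLinearMap)) ε =
        arcCount (wTilde (Y.space t) (LinearMap.range u.toLinearMap)) ε) ∧
      (s < t → arcCount (wTilde (Y.space s) (LinearMap.range u.toLinearMap)) ε +
        Y.crossing u t = arcCount (wTilde (Y.space t) (LinearMap.range u.toLinearMap)) ε) := by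
  have hsin : 0 < Real.sin (ε / 2) :=
    Real.sin_pos_of_pos_of_lt_pi (by linarith [hε.1]) (by linarith [hε.1, hε.2])
  set φ := ε / 2 with hφ
  have hsym : ∀ s, IsUnit (graphFst u φ ∘L Y.F s) →
      (graphOp u φ (Y.F s)).toLinearMap.IsSymmetric := fun s hs =>
    graphOp_isSymmetric hu hsin.ne' hs fun x y => (Y.lagrangian s).2 _ ⟨x, rfl⟩ _ ⟨y, rfl⟩
  obtain ⟨c, hc, hpert⟩ := nonnegCount_perturb (hsym t hX)
  have hcont : ContinuousAt (fun s => graphOp u φ (Y.F s)) t :=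
    (continuous_const.clm_comp Y.F_cont).continuousAt.clm_comp (Y.continuousAt_inverse_graphFst hX)
  have hnorm : ContinuousAt (fun s => ‖graphOp u φ (Y.F s) - graphOp u φ (Y.F t)‖) t :=
    (hcont.sub continuousAt_const).norm
  have hev : ∀ᶠ s in nhds t, ‖graphOp u φ (Y.F s) - graphOp u φ (Y.F t)‖ < c :=
    hnorm.eventually_lt continuousAt_const (by simpa using hc)
  have hker : Module.finrank ℝ (LinearMap.ker (graphOp u φ (Y.F t)).toLinearMap) =
      Y.crossing u t := by
    have h := finrank_inf_rotate hu hsin.ne' hX (ψ := 0) (by rw [sub_zero]; exact hsin.ne')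
    rw [Real.sin_zero, zero_div, Module.End.eigenspace_zero] at h
    have h0 : rotate 0 (LinearMap.range u.toLinearMap) = LinearMap.range u.toLinearMap := by
      ext x
      simp [mem_rotate]
    rw [← h, crossing, space, h0]
  filter_upwards [hev, (Y.isOpen_isUnit_graphFst φ).mem_nhds hX, Y.eventually_pos hX]
    with s hs hXs hpos
  rw [space, space, arcCount_eq_nonnegCount hu hε (Y.lagrangian s) hXs,
    arcCount_eq_nonnegCount hu hε (Y.lagrangian t) hX, ← hker]
  -- The monotonicity: by `hpos`, the difference of the two quadratic forms has the sign of `s - t`.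
  have hdiff : ∀ a, Real.sin φ * (inner ℝ (graphOp u φ (Y.F s) a) a -
      inner ℝ (graphOp u φ (Y.F t) a) a) =
      (s - t) * Y.B (Y.y t (Ring.inverse (graphFst u φ ∘L Y.F t) a))
        (Y.y s (Ring.inverse (graphFst u φ ∘L Y.F s) a)) := by
    intro a
    rw [← Y.omega_eq, omega_apply_inverse hu hsin.ne' hX hXs, real_inner_comm a]
  have hbound : ∀ x, |inner ℝ (graphOp u φ (Y.F s) x) x - inner ℝ (graphOp u φ (Y.F t) x) x| ≤
      c * ‖x‖ ^ 2 := by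
    intro x
    rw [← inner_sub_left, ← sub_apply]
    calc |inner ℝ ((graphOp u φ (Y.F s) - graphOp u φ (Y.F t)) x) x|
        ≤ ‖(graphOp u φ (Y.F s) - graphOp u φ (Y.F t)) x‖ * ‖x‖ := abs_real_inner_le_norm _ _
      _ ≤ (c * ‖x‖) * ‖x‖ := by
          gcongr
          exact (ContinuousLinearMap.le_opNorm _ _).trans
            (mul_le_mul_of_nonneg_right hs.le (norm_nonneg _))
      _ = c * ‖x‖ ^ 2 := by ring
  obtain ⟨h1, h2⟩ := hpert _ (hsym s hXs) hbound
  refine ⟨fun hst => h1 fun a ha => ?_, fun hst => h2 fun a ha => ?_⟩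
  · have := mul_pos (sub_pos.2 hst) (hpos a ha)
    rw [← hdiff] at this
    exact sub_pos.1 ((mul_pos_iff_of_pos_left hsin).1 this)
  · have := mul_neg_of_neg_of_pos (sub_neg.2 hst) (hpos a ha)
    rw [← hdiff] at this
    exact sub_neg.1 (neg_of_mul_neg_right this hsin.le)

/-- The angle parametrizes the circle injectively on `(-π, π)` and the spectrum is finite, so all
but finitely many `ε` avoid it on both sides. -/
theorem exists_gap (hu : IsLagrangian (LinearMap.range u.toLinearMap))
    (t : ℝ) : ∃ ε ∈ Set.Ioo 0 Real.pi,
    IsUnit (graphFst u (ε / 2) ∘L Y.F t) ∧ IsUnit (graphFst u (-ε / 2) ∘L Y.F t) := by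
  set A := wTilde (Y.space t) (LinearMap.range u.toLinearMap) with hA
  have hfin : (Set.Ioo (-Real.pi) Real.pi ∩ {θ | circleEigenspace A θ ≠ ⊥}).Finite := by
    have h1 : {z : ℂ | Module.End.HasEigenvalue (Matrix.toLin' A) z}.Finite :=
      Module.End.finite_hasEigenvalue _
    refine Set.Finite.of_finite_image
      (f := fun θ : ℝ => Complex.exp (Complex.I * ((Real.pi + θ : ℝ) : ℂ))) (h1.subset ?_) ?_
    · rintro _ ⟨θ, hθ, rfl⟩
      exact hθ.2
    · rintro θ ⟨hθ, -⟩ η ⟨hη, -⟩ h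
      have h : Complex.exp (Complex.I * ((Real.pi + θ : ℝ) : ℂ)) =
        Complex.exp (Complex.I * ((Real.pi + η : ℝ) : ℂ)) := h
      rw [Complex.exp_eq_exp_iff_exists_int] at h
      obtain ⟨k, hk⟩ := h
      have h2 : θ = η + k * (2 * Real.pi) := by
        have h3 := congrArg Complex.im hk
        simp at h3
        linarith
      have hk0 : k = 0 := by
        have hp := Real.pi_pos
        have h3 : (k : ℝ) < 1 := by
          by_contra! hge
          nlinarith [hθ.2, hη.1]
        have h4 : (-1 : ℝ) < k := by
          by_contra! hge
          nlinarith [hθ.1, hη.2]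
        have h3' : k < 1 := by exact_mod_cast h3
        have h4' : -1 < k := by exact_mod_cast h4
        omega
      rw [h2, hk0]
      simp
  obtain ⟨ε, hε, hε'⟩ := (Set.Ioo_infinite Real.pi_pos).exists_notMem_finite
    (hfin.union (hfin.preimage (f := fun x => -x) neg_injective.injOn))
  rw [Set.mem_union, not_or] at hε'
  have hpi := hε.2
  have h0 := hε.1
  have e1 : circleEigenspace A ε = ⊥ := by
    by_contra h
    exact hε'.1 ⟨⟨by linarith, hpi⟩, h⟩
  have e2 : circleEigenspace A (-ε) = ⊥ := by
    by_contra h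
    exact hε'.2 ⟨⟨by linarith, by linarith⟩, h⟩
  have hsin : 0 < Real.sin (ε / 2) := Real.sin_pos_of_pos_of_lt_pi (by linarith) (by linarith)
  refine ⟨ε, hε, (Y.circleEigenspace_eq_bot_iff hu hsin.ne' t).1 e1,
    (Y.circleEigenspace_eq_bot_iff hu ?_ t).1 e2⟩
  rw [neg_div, Real.sin_neg]
  linarith

/-- Near `t` the arc count takes one value on each side. A crossing at another point `s` would make
it jump between `s` and a point `r` slightly to the left, on the same side of `t`. -/
theorem eventually_crossing_eq_zero (hu : IsLagrangian (LinearMap.range u.toLinearMap))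
    (t : ℝ) : ∀ᶠ s in nhdsWithin t {t}ᶜ, Y.crossing u s = 0 := by
  obtain ⟨ε, hε, hX, -⟩ := Y.exists_gap hu t
  rw [eventually_nhdsWithin_iff]
  have h := (Y.eventually_arcCount hu hε hX).and ((Y.isOpen_isUnit_graphFst (ε / 2)).mem_nhds hX)
  obtain ⟨δ, hδ, hball⟩ := Metric.eventually_nhds_iff.1 h
  refine Metric.eventually_nhds_iff.2 ⟨δ, hδ, fun s hs hne => ?_⟩
  obtain ⟨⟨h1, h2⟩, h3⟩ := hball hs
  have hev := (Y.eventually_arcCount hu hε h3).and (Metric.isOpen_ball.mem_nhds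
    (show s ∈ Metric.ball t δ from hs))
  rcases lt_or_gt_of_ne (show s ≠ t from hne) with hst | hst
  · obtain ⟨r, ⟨⟨-, h4⟩, h5⟩, h6⟩ :=
      ((hev.filter_mono nhdsWithin_le_nhds).and
        (self_mem_nhdsWithin (a := s) (s := Set.Iio s))).exists
    have h6 : r < s := h6
    have h7 := (hball h5).1.2 (h6.trans hst)
    have h8 := h2 hst
    have h9 := h4 h6
    omega
  · obtain ⟨r, ⟨⟨⟨-, h4⟩, h5⟩, h6⟩, h7⟩ :=
      (((hev.filter_mono nhdsWithin_le_nhds).and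
        (self_mem_nhdsWithin (a := s) (s := Set.Iio s))).and
          (mem_nhdsWithin_of_mem_nhds (Ioi_mem_nhds hst))).exists
    have h6 : r < s := h6
    have h8 := (hball h5).1.1 h7
    have h9 := h1 hst
    have h10 := h4 h6
    omega

end MonotoneFrame

/-! ### Counting functions with locally finite support -/

section Counting

variable {d : ℝ → ℕ}

theorem finite_Icc_inter_support (hd : ∀ t, ∀ᶠ s in nhdsWithin t {t}ᶜ, d s = 0) (a b : ℝ) :
    (Set.Icc a b ∩ Function.support d).Finite := by
  have h : ∀ t ∈ Set.Icc a b, insert t {s | d s = 0} ∈ nhds t := by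
    intro t _
    exact insert_mem_nhds_iff.2 (hd t)
  obtain ⟨T, -, hT⟩ := isCompact_Icc.elim_nhds_subcover _ h
  refine T.finite_toSet.subset ?_
  rintro s ⟨hs, hs'⟩
  obtain ⟨t, ht, hst⟩ := Set.mem_iUnion₂.1 (hT hs)
  rcases hst with rfl | hst
  · exact ht
  · exact absurd hst hs'

theorem finsum_Ioc_add (hd : ∀ t, ∀ᶠ s in nhdsWithin t {t}ᶜ, d s = 0) {a b c : ℝ} (hab : a ≤ b)
    (hbc : b ≤ c) :
    ∑ᶠ x ∈ Set.Ioc a c, d x = ∑ᶠ x ∈ Set.Ioc a b, d x + ∑ᶠ x ∈ Set.Ioc b c, d x := by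
  have hfin : ∀ a b, (Set.Ioc a b ∩ Function.support d).Finite := fun a b =>
    (finite_Icc_inter_support hd a b).subset
      (Set.inter_subset_inter_left _ Set.Ioc_subset_Icc_self)
  rw [← Set.Ioc_union_Ioc_eq_Ioc hab hbc]
  refine finsum_mem_union' ?_ (hfin a b) (hfin b c)
  exact Set.disjoint_left.2 fun x hx hx' => hx'.1.not_ge hx.2

theorem eventually_finsum_Ioc (hd : ∀ t, ∀ᶠ s in nhdsWithin t {t}ᶜ, d s = 0) (t : ℝ) :
    ∀ᶠ s in nhds t, (t < s → ∑ᶠ x ∈ Set.Ioc t s, d x = 0) ∧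
      (s < t → ∑ᶠ x ∈ Set.Ioc s t, d x = d t) := by
  obtain ⟨δ, hδ, hball⟩ := Metric.eventually_nhds_iff.1 (eventually_nhdsWithin_iff.1 (hd t))
  refine Metric.eventually_nhds_iff.2 ⟨δ, hδ, fun s hs => ⟨fun hst => ?_, fun hst => ?_⟩⟩
  · refine finsum_mem_eq_zero_of_forall_eq_zero fun x hx => ?_
    refine hball ?_ (ne_of_gt hx.1)
    rw [Real.dist_eq, abs_lt] at hs ⊢
    constructor <;> linarith [hx.1, hx.2]
  · rw [← finsum_mem_singleton (f := d) (a := t)]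
    refine finsum_mem_inter_support_eq' _ _ _ fun x hx => ?_
    rw [Set.mem_singleton_iff]
    constructor
    · intro hx'
      by_contra hne
      refine hx (hball ?_ hne)
      rw [Real.dist_eq, abs_lt] at hs ⊢
      constructor <;> linarith [hx'.1, hx'.2]
    · rintro rfl
      exact ⟨hst, le_rfl⟩

/-- A function on an interval that is constant to the right of each point `t`, and jumps by `d t`
when `t` is reached from the left, is a counting function. -/
theorem eq_add_finsum_of_eventually (hd : ∀ t, ∀ᶠ s in nhdsWithin t {t}ᶜ, d s = 0) {f : ℝ → ℕ}
    {a b : ℝ} (hab : a ≤ b)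
    (hf : ∀ t ∈ Set.Icc a b, ∀ᶠ s in nhds t, (t < s → f s = f t) ∧ (s < t → f s + d t = f t)) :
    f b = f a + ∑ᶠ x ∈ Set.Ioc a b, d x := by
  -- Once the jumps are subtracted, an integer-valued locally constant function remains, which is
  -- constant on a connected interval.
  set g : ℝ → ℤ := fun t => (f t : ℤ) - ((∑ᶠ x ∈ Set.Ioc a t, d x : ℕ) : ℤ) with hg
  have hcont : ContinuousOn g (Set.Icc a b) := by
    intro t ht
    refine (continuousWithinAt_const (b := g t)).congr_of_eventuallyEq ?_ rfl
    filter_upwards [mem_nhdsWithin_of_mem_nhds (hf t ht),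
      mem_nhdsWithin_of_mem_nhds (eventually_finsum_Ioc hd t), self_mem_nhdsWithin] with s h1 h2 hs
    rcases lt_trichotomy t s with hst | rfl | hst
    · have e1 := h1.1 hst
      have e2 := h2.1 hst
      have e3 := finsum_Ioc_add hd ht.1 hst.le
      simp only [hg]
      omega
    · rfl
    · have e1 := h1.2 hst
      have e2 := h2.2 hst
      have e3 := finsum_Ioc_add hd hs.1 hst.le
      simp only [hg]
      omega
  have h := isPreconnected_Icc.constant hcont (Set.left_mem_Icc.2 hab) (Set.right_mem_Icc.2 hab)
  simp only [hg, Set.Ioc_self, finsum_mem_empty] at h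
  omega

end Counting

/-! ### The Maslov index of a monotone path as a sum of crossing dimensions -/

namespace MonotoneFrame

variable {G : Type*} [NormedAddCommGroup G] [NormedSpace ℝ G] (Y : MonotoneFrame n G)
  {u : Vec n →ₗᵢ[ℝ] PhaseSpace n}

/-- On each step the count for the fixed `ε j` grows by the crossings in the half-open interval,
whatever `ε j` is, so the sum telescopes. -/
theorem flow_eq (hu : IsLagrangian (LinearMap.range u.toLinearMap)) {a b : ℝ}
    (P : FlowPartition (fun t => wTilde (Y.space t) (LinearMap.range u.toLinearMap)) a b) :
    P.flow = ((∑ᶠ x ∈ Set.Ioc a b, Y.crossing u x : ℕ) : ℤ) := by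
  have hd := Y.eventually_crossing_eq_zero hu
  set D : ℝ → ℕ := fun t => ∑ᶠ x ∈ Set.Ioc a t, Y.crossing u x with hD
  have hstep : ∀ j : Fin P.N,
      ((arcCount (wTilde (Y.space (P.t j.succ)) (LinearMap.range u.toLinearMap)) (P.ε j) : ℤ) -
        (arcCount (wTilde (Y.space (P.t j.castSucc)) (LinearMap.range u.toLinearMap))
          (P.ε j) : ℤ)) =
      (D (P.t j.succ) : ℤ) - (D (P.t j.castSucc) : ℤ) := by
    intro j
    have hlt : P.t j.castSucc < P.t j.succ := P.strictMono (Fin.castSucc_lt_succ)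
    have ha : a ≤ P.t j.castSucc := by
      exact P.t_zero.symm.le.trans (P.strictMono.monotone (Fin.zero_le _))
    have hε := P.ε_mem j
    have hsin : 0 < Real.sin (P.ε j / 2) :=
      Real.sin_pos_of_pos_of_lt_pi (by linarith [hε.1]) (by linarith [hε.1, hε.2])
    have h1 := eq_add_finsum_of_eventually hd hlt.le fun t ht =>
      Y.eventually_arcCount hu hε
        ((Y.circleEigenspace_eq_bot_iff hu hsin.ne' t).1 (P.gap j t ht).1)
    have h2 := finsum_Ioc_add hd ha hlt.le
    simp only [hD]
    omega
  rw [FlowPartition.flow, Finset.sum_congr rfl fun j _ => hstep j, Finset.sum_sub_distrib]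
  have h1 := Fin.sum_univ_succ fun i : Fin (P.N + 1) => (D (P.t i) : ℤ)
  have h2 := Fin.sum_univ_castSucc fun i : Fin (P.N + 1) => (D (P.t i) : ℤ)
  have h3 : D (P.t 0) = 0 := by
    simp only [hD, P.t_zero, Set.Ioc_self, finsum_mem_empty]
  rw [P.t_last] at h2
  rw [h3] at h1
  change _ = (D b : ℤ)
  push_cast at h1
  linarith

theorem nonempty_flowPartition (hu : IsLagrangian (LinearMap.range u.toLinearMap)) {a b : ℝ}
    (hab : a < b) :
    Nonempty (FlowPartition
      (fun t => wTilde (Y.space t) (LinearMap.range u.toLinearMap)) a b) := by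
  choose ε hε hgap hgap' using Y.exists_gap hu
  -- Each `ε t` works on a neighbourhood of `t`. With equal steps shorter than the Lebesgue number,
  -- a ball around the left end contains the whole step, so one `ε` serves it.
  obtain ⟨δ, hδ, hball⟩ := lebesgue_number_lemma_of_metric (isCompact_Icc (a := a) (b := b))
    (fun t => (Y.isOpen_isUnit_graphFst (u := u) (ε t / 2)).inter
      (Y.isOpen_isUnit_graphFst (-ε t / 2)))
    (fun t _ => Set.mem_iUnion.2 ⟨t, hgap t, hgap' t⟩)
  obtain ⟨N, hN⟩ := exists_nat_gt ((b - a) / δ)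
  have hN0 : (0 : ℝ) < N := lt_trans (div_pos (sub_pos.2 hab) hδ) hN
  set h := (b - a) / N with hh
  have hpos : 0 < h := div_pos (sub_pos.2 hab) hN0
  have hlt : h < δ := by
    rw [hh, div_lt_iff₀ hN0]
    rw [div_lt_iff₀ hδ] at hN
    linarith
  have hNh : N * h = b - a := by rw [hh]; field_simp
  have hmem : ∀ j : Fin N, a + j * h ∈ Set.Icc a b := by
    intro j
    have h1 : (j : ℝ) ≤ N := by exact_mod_cast j.2.le
    have h2 := mul_le_mul_of_nonneg_right h1 hpos.le
    constructor
    · have : (0 : ℝ) ≤ j * h := by positivity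
      linarith
    · linarith
  choose c hc using fun j : Fin N => hball _ (hmem j)
  refine ⟨⟨N, fun i => a + i * h, fun j => ε (c j), ?_, by simp, ?_, fun j => hε _, ?_⟩⟩
  · intro i j hij
    have : (i : ℝ) < j := by exact_mod_cast hij
    have := mul_lt_mul_of_pos_right this hpos
    change a + i * h < a + j * h
    linarith
  · simp only [Fin.val_last]
    linarith
  · intro j τ hτ
    have hτ' : τ ∈ Metric.ball (a + j * h) δ := by
      rw [Metric.mem_ball, Real.dist_eq, abs_lt]
      simp only [Fin.val_castSucc, Fin.val_succ, Nat.cast_add, Nat.cast_one] at hτ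
      constructor <;> linarith [hτ.1, hτ.2]
    obtain ⟨h1, h2⟩ := hc j hτ'
    have he := hε (c j)
    have hsin : 0 < Real.sin (ε (c j) / 2) :=
      Real.sin_pos_of_pos_of_lt_pi (by linarith [he.1]) (by linarith [he.1, he.2])
    refine ⟨(Y.circleEigenspace_eq_bot_iff hu hsin.ne' τ).2 h1,
      (Y.circleEigenspace_eq_bot_iff hu ?_ τ).2 h2⟩
    rw [neg_div, Real.sin_neg]
    linarith

theorem hasMaslovIndex (hu : IsLagrangian (LinearMap.range u.toLinearMap)) {a b : ℝ}
    (hab : a < b) :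
    HasMaslovIndex Y.space (LinearMap.range u.toLinearMap) a b
      ((∑ᶠ x ∈ Set.Ioc a b, Y.crossing u x : ℕ) : ℤ) where
  target := hu
  lagrangian t _ := Y.lagrangian t
  continuous := Y.continuous_projMatrix.continuousOn
  exists_partition := Y.nonempty_flowPartition hu hab
  flow_eq := Y.flow_eq hu

end MonotoneFrame

/-! ### The Morse index -/

/-- The form `(f, g) ↦ ∫₀¹ ⟪f₁, g₁⟫`, where `f₁`, `g₁` are the first components. -/
def fstForm (n : ℕ) : C(Set.Icc (0 : ℝ) 1, PhaseSpace n) →L[ℝ]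
    C(Set.Icc (0 : ℝ) 1, PhaseSpace n) →L[ℝ] ℝ :=
  LinearMap.mkContinuous₂
    (LinearMap.mk₂ ℝ
      (fun f g => ∫ x in (0 : ℝ)..1, inner ℝ (fstL n (extendUnit f x)) (fstL n (extendUnit g x)))
      (fun f f' g => by
        have h1 := continuous_extendUnit f
        have h2 := continuous_extendUnit f'
        have h3 := continuous_extendUnit g
        rw [← intervalIntegral.integral_add (Continuous.intervalIntegrable (by fun_prop) _ _)
          (Continuous.intervalIntegrable (by fun_prop) _ _)]
        refine intervalIntegral.integral_congr fun x _ => ?_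
        change inner ℝ (fstL n (extendUnit f x + extendUnit f' x)) _ = _
        rw [map_add, inner_add_left])
      (fun c f g => by
        rw [smul_eq_mul, ← intervalIntegral.integral_const_mul]
        refine intervalIntegral.integral_congr fun x _ => ?_
        change inner ℝ (fstL n (c • extendUnit f x)) _ = _
        rw [map_smul, inner_smul_left]
        rfl)
      (fun f g g' => by
        have h1 := continuous_extendUnit f
        have h2 := continuous_extendUnit g
        have h3 := continuous_extendUnit g'
        rw [← intervalIntegral.integral_add (Continuous.intervalIntegrable (by fun_prop) _ _)
          (Continuous.intervalIntegrable (by fun_prop) _ _)]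
        refine intervalIntegral.integral_congr fun x _ => ?_
        change inner ℝ _ (fstL n (extendUnit g x + extendUnit g' x)) = _
        rw [map_add, inner_add_right])
      (fun c f g => by
        rw [smul_eq_mul, ← intervalIntegral.integral_const_mul]
        refine intervalIntegral.integral_congr fun x _ => ?_
        change inner ℝ _ (fstL n (c • extendUnit g x)) = _
        rw [map_smul, inner_smul_right]))
    (‖fstL n‖ * ‖fstL n‖)
    (fun f g => by
      have h := intervalIntegral.norm_integral_le_of_norm_le_const (a := (0 : ℝ)) (b := 1)
        (f := fun x => (inner ℝ (fstL n (extendUnit f x)) (fstL n (extendUnit g x)) : ℝ))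
        (C := ‖fstL n‖ * ‖fstL n‖ * ‖f‖ * ‖g‖) (fun x _ => by
          calc ‖(inner ℝ (fstL n (extendUnit f x)) (fstL n (extendUnit g x)) : ℝ)‖
              ≤ ‖fstL n (extendUnit f x)‖ * ‖fstL n (extendUnit g x)‖ := norm_inner_le_norm _ _
            _ ≤ (‖fstL n‖ * ‖f‖) * (‖fstL n‖ * ‖g‖) :=
                mul_le_mul ((fstL n).le_opNorm_of_le (norm_extendUnit_le f x))
                  ((fstL n).le_opNorm_of_le (norm_extendUnit_le g x)) (norm_nonneg _)
                  (by positivity)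
            _ = ‖fstL n‖ * ‖fstL n‖ * ‖f‖ * ‖g‖ := by ring)
      simpa using h)

theorem fstForm_apply (f g : C(Set.Icc (0 : ℝ) 1, PhaseSpace n)) : fstForm n f g =
    ∫ x in (0 : ℝ)..1, inner ℝ (fstL n (extendUnit f x)) (fstL n (extendUnit g x)) := rfl

/-! ### The Schrödinger path as a monotone frame -/

section

variable {V : ℝ → Matrix (Fin n) (Fin n) ℝ} (hV : ContinuousOn V (Set.Icc 0 1))

theorem fstForm_solOp (lam mu : ℝ) (v w : PhaseSpace n) :
    fstForm n (solOp (sysOp V hV lam) v) (solOp (sysOp V hV mu) w) =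
      ∫ x in (0 : ℝ)..1, inner ℝ (fstL n (solFun (sysOp V hV lam) v x))
        (fstL n (solFun (sysOp V hV mu) w x)) := by
  rw [fstForm_apply]
  refine intervalIntegral.integral_congr fun x hx => ?_
  rw [Set.uIcc_of_le zero_le_one] at hx
  beta_reduce
  rw [solFun_eq _ _ hx, solFun_eq _ _ hx, extendUnit_of_mem _ hx, extendUnit_of_mem _ hx]

/-- The path `t ↦ ℓ(1, -t)`, with the initial values parametrized by `e`. -/
def schrodingerFrame (hs : ∀ x ∈ Set.Icc (0 : ℝ) 1, (V x).IsSymm)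
    (e : Vec n →ₗᵢ[ℝ] PhaseSpace n) (he : IsLagrangian (LinearMap.range e.toLinearMap)) :
    MonotoneFrame n C(Set.Icc (0 : ℝ) 1, PhaseSpace n) where
  F t := monodromy hV (-t) ∘L e.toContinuousLinearMap
  y t := solOp (sysOp V hV (-t)) ∘L e.toContinuousLinearMap
  B := fstForm n
  F_cont := ((continuous_monodromy hV).comp continuous_neg).clm_comp continuous_const
  y_cont := ((continuous_solOp_sysOp hV).comp continuous_neg).clm_comp continuous_const
  F_inj t := (monodromy_injective hV hs (-t)).comp e.injective
  lagrangian t := by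
    have := isLagrangian_map_monodromy hV hs (-t) he
    rwa [← LinearMap.range_comp] at this
  omega_eq t s z w := by
    have h := omega_monodromy hV hs (-t) (-s) (e z) (e w)
    have h0 : omega (e z) (e w) = 0 := he.2 _ ⟨z, rfl⟩ _ ⟨w, rfl⟩
    rw [h0, zero_add, ← fstForm_solOp, neg_sub_neg] at h
    exact h
  pos t z hz := by
    have h := integral_fst_sq_pos hV (-t) (v := e z)
      (fun h => hz (e.injective (by rw [h, map_zero])))
    rw [← fstForm_solOp] at h
    exact h

theorem schrodingerFrame_space (hs : ∀ x ∈ Set.Icc (0 : ℝ) 1, (V x).IsSymm)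
    {e : Vec n →ₗᵢ[ℝ] PhaseSpace n} (he : IsLagrangian (LinearMap.range e.toLinearMap))
    {α₁ α₂ : Matrix (Fin n) (Fin n) ℝ} (h : LinearMap.range e.toLinearMap = targetSpace α₁ α₂)
    (t : ℝ) : (schrodingerFrame hV hs e he).space t = traceSpace V α₁ α₂ 1 (-t) := by
  rw [traceSpace_eq hV, ← h, ← LinearMap.range_comp]
  rfl

end

/-- Finite support is essential: with infinite support the `finsum` would take its default value 0.
-/
theorem tsum_Iio_eq_finsum {d : ℝ → ℕ} (hfin : (Set.Ioi 0 ∩ Function.support d).Finite) :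
    ∑' μ : Set.Iio (0 : ℝ), (d (-μ) : ℕ∞) = ((∑ᶠ x ∈ Set.Ioi (0 : ℝ), d x : ℕ) : ℕ∞) := by
  let e : Set.Ioi (0 : ℝ) ≃ Set.Iio (0 : ℝ) :=
    { toFun := fun x => ⟨-x, Set.mem_Iio.2 (neg_lt_zero.2 x.2)⟩
      invFun := fun x => ⟨-x, Set.mem_Ioi.2 (neg_pos.2 x.2)⟩
      left_inv := fun x => by simp
      right_inv := fun x => by simp }
  rw [← e.tsum_eq]
  simp only [e, Equiv.coe_fn_mk, neg_neg]
  rw [tsum_subtype (Set.Ioi (0 : ℝ)) (fun x => (d x : ℕ∞)),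
    finsum_mem_eq_sum_of_inter_support_eq (t := hfin.toFinset) d (by
      rw [Set.Finite.coe_toFinset, Set.inter_assoc, Set.inter_self]),
    tsum_eq_sum (s := hfin.toFinset)]
  · rw [Nat.cast_sum]
    refine Finset.sum_congr rfl fun x hx => ?_
    rw [Set.Finite.mem_toFinset] at hx
    rw [Set.indicator_of_mem hx.1]
  · intro x hx
    rw [Set.Finite.mem_toFinset, Set.mem_inter_iff, not_and, Function.notMem_support] at hx
    by_cases h : x ∈ Set.Ioi (0 : ℝ)
    · rw [Set.indicator_of_mem h, hx h, Nat.cast_zero]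
    · rw [Set.indicator_of_notMem h]

end MaslovMorse

end

/-! ### The main theorem -/

open MaslovMorse
theorem lemma3p6 (n : ℕ) (V : ℝ → Matrix (Fin n) (Fin n) ℝ)
    (α₁ α₂ β₁ β₂ : Matrix (Fin n) (Fin n) ℝ)
    (hVcont : ContinuousOn V (Set.Icc 0 1))
    (hVsymm : ∀ x ∈ Set.Icc (0 : ℝ) 1, (V x).IsSymm)
    (hαrank : (Matrix.fromCols α₁ α₂).rank = n)
    (hβrank : (Matrix.fromCols β₁ β₂).rank = n)
    (hα : α₁ * α₂.transpose - α₂ * α₁.transpose = 0)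
    (hβ : β₁ * β₂.transpose - β₂ * β₁.transpose = 0) :
    ∃ m : ℕ, morseIndex V α₁ α₂ β₁ β₂ = (m : ℕ∞) ∧
      (∃ L : ℝ, 0 < L ∧
        ∀ lam < -L, traceSpace V α₁ α₂ 1 lam ⊓ targetSpace β₁ β₂ = ⊥) ∧
      ∀ L : ℝ, 0 < L →
        (∀ lam < -L, traceSpace V α₁ α₂ 1 lam ⊓ targetSpace β₁ β₂ = ⊥) →
        HasMaslovIndex (fun t => traceSpace V α₁ α₂ 1 (-t)) (targetSpace β₁ β₂) 0 L (m : ℤ) := by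
  have hlα := isLagrangian_targetSpace hαrank hα
  have hlβ := isLagrangian_targetSpace hβrank hβ
  obtain ⟨e, he⟩ := hlα.exists_isometry
  obtain ⟨u, hu⟩ := hlβ.exists_isometry
  have heL : IsLagrangian (LinearMap.range e.toLinearMap) := he ▸ hlα
  have huL : IsLagrangian (LinearMap.range u.toLinearMap) := hu ▸ hlβ
  set Y := schrodingerFrame hVcont hVsymm e heL with hY
  have hspace : ∀ t, Y.space t = traceSpace V α₁ α₂ 1 (-t) :=
    schrodingerFrame_space hVcont hVsymm heL he
  have hcross : ∀ t, Y.crossing u t = Module.finrank ℝ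
      (traceSpace V α₁ α₂ 1 (-t) ⊓ targetSpace β₁ β₂ : Submodule ℝ (PhaseSpace n)) := by
    intro t
    rw [MonotoneFrame.crossing, hspace, hu]
  have hd := Y.eventually_crossing_eq_zero huL
  have hL : ∃ L : ℝ, 0 < L ∧
      ∀ lam < -L, traceSpace V α₁ α₂ 1 lam ⊓ targetSpace β₁ β₂ = ⊥ := by
    simp only [traceSpace_eq hVcont]
    exact exists_forall_inf_eq_bot hVcont hlα hlβ
  -- Only `λ < -L` is free of crossings, so `t = L` may be one and the interval is closed there.
  have hsupp : ∀ L : ℝ, (∀ lam < -L, traceSpace V α₁ α₂ 1 lam ⊓ targetSpace β₁ β₂ = ⊥) →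
      Set.Ioi 0 ∩ Function.support (Y.crossing u) =
        Set.Ioc 0 L ∩ Function.support (Y.crossing u) := by
    intro L h
    ext x
    simp only [Set.mem_inter_iff, Set.mem_Ioi, Set.mem_Ioc, Function.mem_support]
    refine ⟨fun hx => ⟨⟨hx.1, ?_⟩, hx.2⟩, fun hx => ⟨hx.1.1, hx.2⟩⟩
    by_contra hlt
    refine hx.2 ?_
    rw [hcross, h (-x) (by linarith), finrank_bot]
  -- The sum runs over all `λ = -x < 0` and does not mention `L`, so one number serves every
  -- admissible `L`.
  refine ⟨∑ᶠ x ∈ Set.Ioi (0 : ℝ), Y.crossing u x, ?_, hL, fun L hL0 h => ?_⟩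
  · obtain ⟨L, hL0, h⟩ := hL
    rw [← tsum_Iio_eq_finsum, morseIndex]
    · refine tsum_congr fun mu => ?_
      rw [toENat_rank_eigenspaceH hVcont hVsymm, hcross, neg_neg]
    · rw [hsupp L h]
      exact (finite_Icc_inter_support hd 0 L).subset
        (Set.inter_subset_inter_left _ Set.Ioc_subset_Icc_self)
  · have hM := Y.hasMaslovIndex huL hL0
    rw [finsum_mem_inter_support_eq _ _ _ (hsupp L h)]
    rw [hu, funext hspace] at hM
    exact hM
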